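/- Let $0<a<r$ be coprime integers, let $b$ be the inverse of $a$ modulo $r$, and write $[s]_t$ for the least non-negative residue of $s$ modulo $t$. Let $N=\mathbb Ze_1+\mathbb Ze_2+\mathbb Ze_3+\mathbb Z\,\tfrac1r(1,a,r-a)$, $M=\operatorname{Hom}(N,\mathbb Z)$, $T=\operatorname{Spec}\mathbb C[M]$, $U_\sigma=\operatorname{Spec}\mathbb C[\sigma^\vee\cap M]$ for a cone $\sigma$ in $N\otimes\mathbb R$, and $p_i=\tfrac1r([-ib]_r,\,r-i,\,i)$ for $0\le i\le r$. The Danilov resolution $Y$ of the singularity $\tfrac1r(1,a,r-a)$ is the toric variety of the fan obtained recursively as follows: subdivide the octant $\langle e_1,e_2,e_3\rangle$ at $p_{r-a}=\tfrac1r(1,a,r-a)$ into $\langle e_2,e_3,p_{r-a}\rangle$, $\langle e_1,e_2,p_{r-a}\rangle$ and $\langle e_1,e_3,p_{r-a}\rangle$, and then replace the second and the third cone by the images of the fans of the Danilov resolutions of $\tfrac1{r-a}(1,[r]_{r-a},[-r]_{r-a})$ and $\tfrac1a(1,[-r]_a,[r]_a)$ under the linear maps $(e_1,e_2,e_3)\mapsto(e_1,e_2,p_{r-a})$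 and $(e_1,e_2,e_3)\mapsto(e_1,p_{r-a},e_3)$ respectively; for the trivial singularity (order $1$) the fan is the octant itself. Its three-dimensional cones that contain $e_1$ are $\sigma_i=\langle p_i,p_{i+1},e_1\rangle$, $i=0,\dots,r-1$. Let $D_k$ and $E_1$ be the $T$-invariant prime divisors of the rays through $p_k$ and $e_1$. Define $\tau(r,a,i)$ for $0\le i<r$ by $\tau(r,a,i)=[ai-1]_r$ if $a\in\{1,r-1\}$, and otherwise $\tau(r,a,i)=\tau(r-a,[r]_{r-a},[i]_{r-a})$ for $i\ge a$ and $\tau(r,a,i)=(r-a)+\tau(a,[-r]_a,i)$ for $i<a$. With indices modulo $r$, let $$Y_{i-a}=\sum_{k=0}^{\tau(r,a,i)}D_k,\qquad Z_i=\sum_{k=\tau(r,a,i)+1}^{r}D_k,$$ and let $X_i$ be the unique divisors with $X_0=E_1$ and $X_i+Z_{i+1}=Z_i+X_{i-a}$ for all $i$. The McKay quiver has vertices $0,\dots,r-1$ (modulo $r$) and arrows $x_i:i\to i+1$, $y_i:i\to i+a$, $z_i:i\to i-a$. The natural sections of the line bundles $\mathcal O(X_i),\mathcal O(Y_i),\mathcal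 O(Z_i)$, attached to the arrows $x_i,y_i,z_i$, define a family $\mathcal F$ of representations of the McKay quiver of dimension vector $(1,\dots,1)$ on $Y$; let $\mathcal F_s$ be its member at a closed point $s\in Y$, defined up to isomorphism, and let $\mathcal F_i$ be its member at the $T$-fixed point of $U_{\sigma_i}$, for $i=0,\dots,r-1$. For $\theta\in\mathbb Q^r$ with $\sum_v\theta_v=0$, a representation $V$ of dimension vector $(1,\dots,1)$ is called $\theta$-semistable (respectively $\theta$-stable) if $\sum_v\theta_v\dim V'_v\ge 0$ (respectively $>0$) for every non-zero proper subrepresentation $V'\subset V$. **Statement.** Let $\theta\in\mathbb Q^r$ with $\sum_v\theta_v=0$. If $\mathcal F_0,\dots,\mathcal F_{r-1}$ are all $\theta$-semistable, then $\mathcal F_s$ is $\theta$-semistable for every closed point $s\in Y$. If $\mathcal F_0,\dots,\mathcal F_{r-1}$ are all $\theta$-stable, then $\mathcal F_s$ is $\theta$-stable for every closed point $s\in Y$. -/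

import Mathlib

noncomputable section

namespace Danilov

/-! ### Representations of quivers and stability -/

/-- Representations of the quiver `Q` with dimension vector `δ`. -/
def Rep (Q : Type) [Quiver.{0} Q] (δ : Q → ℕ) : Type :=
  ∀ ⦃v w : Q⦄, (v ⟶ w) → ((Fin (δ v) → ℂ) →ₗ[ℂ] (Fin (δ w) → ℂ))

/-- Isomorphism of representations, i.e. lying in the same orbit of `∏ GL(δ(v), ℂ)`. -/
def Rep.Isomorphic {Q : Type} [Quiver.{0} Q] {δ : Q → ℕ} (V V' : Rep Q δ) : Prop :=
  ∃ g : ∀ v : Q, (Fin (δ v) → ℂ) ≃ₗ[ℂ] (Fin (δ v) → ℂ),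
    ∀ ⦃v w : Q⦄ (f : v ⟶ w) (u : Fin (δ v) → ℂ), V' f (g v u) = g w (V f u)

/-- Subrepresentations of a representation of `Q`. -/
structure Subrep {Q : Type} [Quiver.{0} Q] {δ : Q → ℕ} (V : Rep Q δ) where
  space : ∀ v : Q, Submodule ℂ (Fin (δ v) → ℂ)
  map_mem : ∀ ⦃v w : Q⦄ (f : v ⟶ w) (u : Fin (δ v) → ℂ), u ∈ space v → V f u ∈ space w

namespace Subrep

variable {Q : Type} [Quiver.{0} Q] {δ : Q → ℕ} {V : Rep Q δ}

/-- The dimension vector of a subrepresentation. -/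
def dim (W : Subrep V) : Q → ℕ := fun v => Module.finrank ℂ (W.space v)

def IsNonzero (W : Subrep V) : Prop := ∃ v, W.space v ≠ ⊥

def IsProper (W : Subrep V) : Prop := ∃ v, W.space v ≠ ⊤

end Subrep

/-- The weight space `Wt(Q)`: rational functions on the vertices with sum zero. -/
def Wt (Q : Type) [Fintype Q] : Type := {θ : Q → ℚ // ∑ v, θ v = 0}

/-- The value `∑ θ(v) δ(v)` of a weight on a dimension vector. -/
def Wt.eval {Q : Type} [Fintype Q] (θ : Wt Q) (δ : Q → ℕ) : ℚ := ∑ v, θ.1 v * (δ v : ℚ)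

/-- `θ`-semistability (King). -/
def IsSemistable {Q : Type} [Quiver.{0} Q] [Fintype Q] {δ : Q → ℕ} (θ : Wt Q)
    (V : Rep Q δ) : Prop :=
  θ.eval δ = 0 ∧ ∀ W : Subrep V, W.IsNonzero → W.IsProper → 0 ≤ θ.eval W.dim

/-- `θ`-stability (King). -/
def IsStable {Q : Type} [Quiver.{0} Q] [Fintype Q] {δ : Q → ℕ} (θ : Wt Q)
    (V : Rep Q δ) : Prop :=
  θ.eval δ = 0 ∧ ∀ W : Subrep V, W.IsNonzero → W.IsProper → 0 < θ.eval W.dim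

/-! ### The McKay quiver of type `1/r (1, a, r - a)` -/

/-- The vertices `0, …, r - 1` of the McKay quiver, taken modulo `r`. -/
def McKayQuiver (r _a : ℕ) : Type := ZMod r

instance (r a : ℕ) [NeZero r] : Fintype (McKayQuiver r a) := inferInstanceAs (Fintype (ZMod r))

/-- The `3r` arrows `x_i : i → i + 1`, `y_i : i → i + a`, `z_i : i → i - a`. -/
inductive McKayArrow (r a : ℕ) : ZMod r → ZMod r → Type
  | x (i : ZMod r) : McKayArrow r a i (i + 1)
  | y (i : ZMod r) : McKayArrow r a i (i + (a : ZMod r))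
  | z (i : ZMod r) : McKayArrow r a i (i - (a : ZMod r))

instance (r a : ℕ) : Quiver.{0} (McKayQuiver r a) := ⟨fun i j => McKayArrow r a i j⟩

/-! ### Lattices, cones and toric charts -/

/-- `N(r,a) ⊗ ℝ`, in the basis `e₁, e₂, e₃`. -/
abbrev Vec : Type := Fin 3 → ℝ

def e₁ : Vec := ![1, 0, 0]
def e₂ : Vec := ![0, 1, 0]
def e₃ : Vec := ![0, 0, 1]

/-- `N(r,a) = ℤe₁ + ℤe₂ + ℤe₃ + ℤ · (1/r)(e₁ + a e₂ + (r - a) e₃)`. -/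
def latticeN (r a : ℕ) : AddSubgroup Vec :=
  AddSubgroup.closure {e₁, e₂, e₃, (r : ℝ)⁻¹ • ![1, (a : ℝ), (r : ℝ) - (a : ℝ)]}

/-- `M(r,a) = Hom(N(r,a), ℤ)`, written in the dual basis `e₁*, e₂*, e₃*`; the pairing of
`M(r,a)` with `N(r,a) ⊗ ℝ` is then the dot product. -/
def latticeM (r a : ℕ) : AddSubgroup Vec where
  carrier := {m | ∀ n ∈ latticeN r a, ∃ k : ℤ, m ⬝ᵥ n = (k : ℝ)}
  zero_mem' := fun n _ => ⟨0, by simp⟩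
  add_mem' := by
    intro m m' hm hm' n hn
    obtain ⟨k, hk⟩ := hm n hn
    obtain ⟨k', hk'⟩ := hm' n hn
    exact ⟨k + k', by rw [add_dotProduct, hk, hk']; push_cast; rfl⟩
  neg_mem' := by
    intro m hm n hn
    obtain ⟨k, hk⟩ := hm n hn
    exact ⟨-k, by rw [neg_dotProduct, hk]; push_cast; rfl⟩

/-- The monoid `σ^∨ ∩ M(r,a)`. -/
def dualMonoid (r a : ℕ) (σ : PointedCone ℝ Vec) : AddSubmonoid Vec where
  carrier := {m | m ∈ latticeM r a ∧ ∀ v ∈ σ, 0 ≤ m ⬝ᵥ v}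
  zero_mem' := ⟨zero_mem _, fun v _ => by simp⟩
  add_mem' := by
    rintro m m' ⟨hm, h⟩ ⟨hm', h'⟩
    refine ⟨add_mem hm hm', fun v hv => ?_⟩
    rw [add_dotProduct]
    exact add_nonneg (h v hv) (h' v hv)

theorem dualMonoid_anti (r a : ℕ) {σ τ : PointedCone ℝ Vec} (h : τ ≤ σ) :
    dualMonoid r a σ ≤ dualMonoid r a τ :=
  fun _ hm => ⟨hm.1, fun v hv => hm.2 v (h hv)⟩

/-- The closed points of the toric chart `U_σ = Spec ℂ[σ^∨ ∩ M(r,a)]`. -/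
abbrev Chart (r a : ℕ) (σ : PointedCone ℝ Vec) : Type :=
  AddMonoidAlgebra ℂ (dualMonoid r a σ) →ₐ[ℂ] ℂ

/-- The value at the point `s` of `U_σ` of the regular function `χ^m`. -/
def Chart.character {r a : ℕ} {σ : PointedCone ℝ Vec} (s : Chart r a σ)
    (m : dualMonoid r a σ) : ℂ :=
  s (AddMonoidAlgebra.single m 1)

/-- The map `U_τ → U_σ` for a subcone `τ` of `σ` (an open immersion if `τ` is a face of `σ`). -/
def Chart.restrict {r a : ℕ} {σ τ : PointedCone ℝ Vec} (h : τ ≤ σ) (s : Chart r a τ) :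
    Chart r a σ :=
  s.comp (AddMonoidAlgebra.mapDomainAlgHom ℂ ℂ
    (AddSubmonoid.inclusion (dualMonoid_anti r a h)))

/-- The points of `U_σ` fixed by the torus `T = Spec ℂ[M(r,a)]`, whose closed points are the
homomorphisms `t : M(r,a) → ℂˣ`, acting by `χ^m(t · s) = t(m) χ^m(s)`. -/
def Chart.IsTorusFixed {r a : ℕ} {σ : PointedCone ℝ Vec} (s : Chart r a σ) : Prop :=
  ∀ (t : Multiplicative (latticeM r a) →* ℂˣ) (m : dualMonoid r a σ),
    (t (Multiplicative.ofAdd ⟨m.1, m.2.1⟩) : ℂ) * s.character m = s.character m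

open scoped Classical in
/-- The distinguished point of `U_σ`, at which `χ^m` is `1` for `m ∈ σ^⊥` and `0` for all other
`m ∈ σ^∨ ∩ M(r,a)`. -/
def torusFixedPoint (r a : ℕ) (σ : PointedCone ℝ Vec) : Chart r a σ :=
  AddMonoidAlgebra.lift ℂ ℂ (dualMonoid r a σ)
    { toFun := fun m => if ∀ v ∈ σ, m.toAdd.1 ⬝ᵥ v = 0 then 1 else 0
      map_one' := by simp
      map_mul' := by
        intro m m'
        have key : (∀ v ∈ σ, (m * m').toAdd.1 ⬝ᵥ v = 0) ↔
            (∀ v ∈ σ, m.toAdd.1 ⬝ᵥ v = 0) ∧ (∀ v ∈ σ, m'.toAdd.1 ⬝ᵥ v = 0) := by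
          have hadd : ∀ v, (m * m').toAdd.1 ⬝ᵥ v = m.toAdd.1 ⬝ᵥ v + m'.toAdd.1 ⬝ᵥ v := by
            intro v
            rw [← add_dotProduct]
            rfl
          constructor
          · intro h
            constructor <;> intro v hv <;>
              linarith [h v hv, hadd v, m.toAdd.2.2 v hv, m'.toAdd.2.2 v hv]
          · rintro ⟨h, h'⟩ v hv
            rw [hadd, h v hv, h' v hv, add_zero]
        by_cases h : ∀ v ∈ σ, m.toAdd.1 ⬝ᵥ v = 0
        · by_cases h' : ∀ v ∈ σ, m'.toAdd.1 ⬝ᵥ v = 0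
          · rw [if_pos (key.2 ⟨h, h'⟩), if_pos h, if_pos h', mul_one]
          · rw [if_neg (fun hc => h' (key.1 hc).2), if_neg h', mul_zero]
        · rw [if_neg (fun hc => h (key.1 hc).1), if_neg h, zero_mul] }

theorem character_torusFixedPoint (r a : ℕ) (σ : PointedCone ℝ Vec) (m : dualMonoid r a σ) :
    (∀ v ∈ σ, m.1 ⬝ᵥ v = 0) ∧ (torusFixedPoint r a σ).character m = 1 ∨
      (¬ ∀ v ∈ σ, m.1 ⬝ᵥ v = 0) ∧ (torusFixedPoint r a σ).character m = 0 := by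
  classical
  have h : (torusFixedPoint r a σ).character m = if ∀ v ∈ σ, m.1 ⬝ᵥ v = 0 then 1 else 0 := by
    unfold Chart.character torusFixedPoint
    rw [AddMonoidAlgebra.lift_single, one_smul]
    rfl
  by_cases h' : ∀ v ∈ σ, m.1 ⬝ᵥ v = 0
  · exact Or.inl ⟨h', by rw [h, if_pos h']⟩
  · exact Or.inr ⟨h', by rw [h, if_neg h']⟩

/-- If `σ` is full-dimensional, the distinguished point is the unique torus fixed point. -/
theorem isTorusFixed_iff (r a : ℕ) (σ : PointedCone ℝ Vec)
    (hσ : ∀ m : Vec, (∀ v ∈ σ, m ⬝ᵥ v = 0) → m = 0) (s : Chart r a σ) :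
    s.IsTorusFixed ↔ s = torusFixedPoint r a σ := by
  have one : ∀ s' : Chart r a σ, ∀ m : dualMonoid r a σ, m.1 = 0 → s'.character m = 1 := by
    intro s' m hm
    have : m = 0 := Subtype.ext hm
    subst this
    exact map_one s'
  constructor
  · intro hs
    have hval : ∀ m, s.character m = (torusFixedPoint r a σ).character m := by
      intro m
      by_cases hm : m.1 = 0
      · rw [one s m hm, one _ m hm]
      rcases character_torusFixedPoint r a σ m with ⟨h, _⟩ | ⟨_, h⟩
      · exact absurd (hσ _ h) hm
      rw [h]
      obtain ⟨c, hc⟩ : ∃ c : Fin 3, m.1 c ≠ 0 := by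
        by_contra! hcon
        exact hm (funext hcon)
      set n : Vec := Pi.single c 1 with hn
      have hnN : n ∈ latticeN r a := by
        refine AddSubgroup.subset_closure ?_
        have e1 : (Pi.single 0 1 : Vec) = e₁ := by ext k; fin_cases k <;> rfl
        have e2 : (Pi.single 1 1 : Vec) = e₂ := by ext k; fin_cases k <;> rfl
        have e3 : (Pi.single 2 1 : Vec) = e₃ := by ext k; fin_cases k <;> rfl
        fin_cases c
        · exact Or.inl e1
        · exact Or.inr (Or.inl e2)
        · exact Or.inr (Or.inr (Or.inl e3))
      have hint : ∀ m' : latticeM r a, ∃ k : ℤ, m'.1 c = (k : ℝ) := by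
        intro m'
        obtain ⟨k, hk⟩ := m'.2 n hnN
        exact ⟨k, by rw [← hk, hn, dotProduct_single, mul_one]⟩
      choose g hg using hint
      let t : Multiplicative (latticeM r a) →* ℂˣ :=
        { toFun := fun m' => (Units.mk0 (2 : ℂ) two_ne_zero) ^ g m'.toAdd
          map_one' := by
            have : g 0 = 0 := by
              have h0 := hg 0
              have : ((0 : latticeM r a) : Vec) c = 0 := rfl
              rw [this] at h0
              exact_mod_cast h0.symm
            rw [toAdd_one, this, zpow_zero]
          map_mul' := by
            intro u w
            have : g (u.toAdd + w.toAdd) = g u.toAdd + g w.toAdd := by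
              have h1 := hg (u.toAdd + w.toAdd)
              have h2 : ((u.toAdd + w.toAdd : latticeM r a) : Vec) c
                  = (u.toAdd : Vec) c + (w.toAdd : Vec) c := rfl
              rw [h2, hg, hg] at h1
              exact_mod_cast h1.symm
            rw [toAdd_mul, this, zpow_add] }
      have h1 := hs t m
      by_contra hne
      have h2 : (t (Multiplicative.ofAdd ⟨m.1, m.2.1⟩) : ℂ) = 1 := by
        have : (t (Multiplicative.ofAdd ⟨m.1, m.2.1⟩) : ℂ) * s.character m
            = 1 * s.character m := by rw [h1, one_mul]
        exact mul_right_cancel₀ hne this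
      have h3 : (2 : ℂ) ^ g ⟨m.1, m.2.1⟩ = 1 := by
        rw [← h2]
        simp [t]
      have h4 : (2 : ℝ) ^ g ⟨m.1, m.2.1⟩ = 1 := by
        have := congrArg norm h3
        rwa [norm_zpow, norm_one, Complex.norm_ofNat] at this
      have h5 : g ⟨m.1, m.2.1⟩ = 0 :=
        (zpow_eq_one_iff_right₀ (by norm_num) (by norm_num)).1 h4
      apply hc
      have := hg ⟨m.1, m.2.1⟩
      rw [h5] at this
      simpa using this
    exact AddMonoidAlgebra.algHom_ext hval (Subsingleton.elim _ _)
  · rintro rfl t m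
    rcases character_torusFixedPoint r a σ m with ⟨h, _⟩ | ⟨_, h⟩
    · have h0 : m.1 = 0 := hσ _ h
      have : (⟨m.1, m.2.1⟩ : latticeM r a) = 0 := Subtype.ext h0
      rw [this, ofAdd_zero, map_one, Units.val_one, one_mul]
    · rw [h, mul_zero]

/-! ### The fan of the Danilov resolution -/

/-- The least non-negative integer `u` such that `t` divides `s - u`. -/
def lnr (s : ℤ) (t : ℕ) : ℕ := (s % (t : ℤ)).toNat

/-- The points `p_i = (1/r)(⟦-ib⟧_r, r - i, i)` for `i = 0, …, r`, where `b` is the inverse of `a`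
modulo `r`. -/
def p (r a i : ℕ) : Vec :=
  (r : ℝ)⁻¹ • ![((-((i : ZMod r) * (a : ZMod r)⁻¹)).val : ℝ), (r : ℝ) - (i : ℝ), (i : ℝ)]

/-- A `3`-dimensional simplicial cone is given by its three primitive ray generators. -/
abbrev Triple : Type := Fin 3 → Vec

/-- The cone spanned by a triple of vectors. -/
def Triple.cone (σ : Triple) : PointedCone ℝ Vec := PointedCone.hull ℝ (Set.range σ)

/-- The linear map `L(r,a)`: `e₁ ↦ e₁`, `e₂ ↦ e₂`, `e₃ ↦ p_{r-a}`. -/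
def mapL (r a : ℕ) (v : Vec) : Vec := v 0 • e₁ + v 1 • e₂ + v 2 • p r a (r - a)

/-- The linear map `R(r,a)`: `e₁ ↦ e₁`, `e₂ ↦ p_{r-a}`, `e₃ ↦ e₃`. -/
def mapR (r a : ℕ) (v : Vec) : Vec := v 0 • e₁ + v 1 • p r a (r - a) + v 2 • e₃

/-- The `3`-dimensional cones of the fan of the Danilov resolution of `1/r (1, a, r - a)`.
For `r > 1` the octant is subdivided at `p_{r-a}` into `⟨e₂, e₃, p_{r-a}⟩`, `⟨e₁, e₂, p_{r-a}⟩` and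
`⟨e₁, e₃, p_{r-a}⟩`, and the last two are replaced by the images under `L(r,a)` and `R(r,a)` of the
fans of the Danilov resolutions of `1/(r-a) (1, ⟦r⟧, ⟦-r⟧)` and `1/a (1, ⟦-r⟧, ⟦r⟧)`. If `r = 1`
(where the second parameter is `0`) nothing is subdivided. -/
def fan (r a : ℕ) : Set Triple :=
  if _h : 0 < a ∧ a < r then
    (fun σ : Triple => fun k => mapL r a (σ k)) '' fan (r - a) (lnr r (r - a)) ∪
    (fun σ : Triple => fun k => mapR r a (σ k)) '' fan a (lnr (-r) a) ∪
    {![p r a (r - a), e₂, e₃]}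
  else {![e₁, e₂, e₃]}
termination_by r
decreasing_by all_goals omega

/-- The cones `σ_i = ⟨p_i, p_{i+1}, e₁⟩`, `i = 0, …, r - 1`. -/
def topCone (r a i : ℕ) : Triple := ![p r a i, p r a (i + 1), e₁]

theorem topCone_spans (r a i : ℕ) [NeZero r] (m : Vec)
    (hm : ∀ v ∈ (topCone r a i).cone, m ⬝ᵥ v = 0) : m = 0 := by
  have hmem : ∀ k, m ⬝ᵥ topCone r a i k = 0 := fun k =>
    hm _ (PointedCone.subset_hull ⟨k, rfl⟩)
  have hr : (r : ℝ) ≠ 0 := Nat.cast_ne_zero.2 (NeZero.ne r)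
  have h0 := hmem 0
  have h1 := hmem 1
  have h2 := hmem 2
  simp only [topCone, p, e₁, dotProduct, Fin.sum_univ_three, Matrix.cons_val_zero,
    Matrix.cons_val_one, Matrix.cons_val, Pi.smul_apply, smul_eq_mul, mul_one, mul_zero,
    add_zero] at h0 h1 h2
  rw [h2] at h0 h1
  field_simp at h0 h1
  push_cast at h0 h1
  have hz : m 1 = m 2 := by linarith
  have hy : m 1 * r = 0 := by rw [← hz] at h0; linarith
  have hy' : m 1 = 0 := (mul_eq_zero.1 hy).resolve_right hr
  ext k
  fin_cases k
  · exact h2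
  · exact hy'
  · exact hz ▸ hy'

/-- The distinguished point of `U_{σ_i}` is its unique torus fixed point. -/
theorem isTorusFixed_topCone_iff (r a i : ℕ) [NeZero r] (s : Chart r a (topCone r a i).cone) :
    s.IsTorusFixed ↔ s = torusFixedPoint r a (topCone r a i).cone :=
  isTorusFixed_iff r a _ (topCone_spans r a i) s

/-- Closed points of the disjoint union of the charts of the Danilov resolution. -/
def ChartPoint (r a : ℕ) : Type := Σ σ : fan r a, Chart r a σ.1.cone

/-- Toric gluing: points of `U_σ` and `U_τ` are identified if they come from a common point of
`U_{σ ∩ τ}`. -/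
def Glue (r a : ℕ) (x y : ChartPoint r a) : Prop :=
  ∃ z : Chart r a (x.1.1.cone ⊓ y.1.1.cone),
    z.restrict inf_le_left = x.2 ∧ z.restrict inf_le_right = y.2

/-- The closed points of the Danilov resolution of `1/r (1, a, r - a)`. -/
def Resolution (r a : ℕ) : Type := Quot (Glue r a)

/-! ### The divisors `X_i`, `Y_i`, `Z_i` -/

/-- Torus invariant divisors, as formal sums of the prime divisors `D_v` indexed by the primitive
generators `v` of rays. -/
abbrev TDiv : Type := Vec →₀ ℤ

/-- The divisor `D_k` of the ray generated by `p_k`. -/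
def divD (r a k : ℕ) : TDiv := Finsupp.single (p r a k) 1

/-- The divisor `E₁` of the ray generated by `e₁`. -/
def divE₁ : TDiv := Finsupp.single e₁ 1

/-- The permutation `τ(r,a,·)` of `{0, …, r - 1}`; the last branch is never reached for
coprime `0 < a < r`. -/
def tau (r a i : ℕ) : ℕ :=
  if a = 1 ∨ a + 1 = r then lnr (a * i - 1) r
  else if _h : 0 < a ∧ a < r then
    if a ≤ i then tau (r - a) (lnr r (r - a)) (lnr i (r - a))
    else (r - a) + tau a (lnr (-r) a) i
  else 0
termination_by r
decreasing_by all_goals omega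

/-- `Y_{i-a} = ∑_{k=0}^{τ(r,a,i)} D_k`. -/
def divY (r a : ℕ) (j : ZMod r) : TDiv :=
  ∑ k ∈ Finset.Icc 0 (tau r a (j + (a : ZMod r)).val), divD r a k

/-- `Z_i = ∑_{k=τ(r,a,i)+1}^{r} D_k`. -/
def divZ (r a : ℕ) (i : ZMod r) : TDiv :=
  ∑ k ∈ Finset.Icc (tau r a i.val + 1) r, divD r a k

/-- The divisors `X_i`: the unique solution of `X_i + Z_{i+1} = Z_i + X_{i-a}` with `X_0 = E₁`
(see `divX_zero`, `divX_add`, `divX_unique`). -/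
def divX (r a : ℕ) (i : ZMod r) : TDiv :=
  divE₁ + ∑ k ∈ Finset.range (i * (a : ZMod r)⁻¹).val,
    (divZ r a (((k + 1 : ℕ) : ZMod r) * (a : ZMod r)) -
      divZ r a (((k + 1 : ℕ) : ZMod r) * (a : ZMod r) + 1))

theorem divX_zero (r a : ℕ) : divX r a 0 = divE₁ := by
  simp [divX]

theorem divX_add (r a : ℕ) [NeZero r] (h : Nat.Coprime r a) (i : ZMod r) :
    divX r a i + divZ r a (i + 1) = divZ r a i + divX r a (i - (a : ZMod r)) := by
  have hab : (a : ZMod r) * (a : ZMod r)⁻¹ = 1 := ZMod.coe_mul_inv_eq_one a h.symm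
  set f : ZMod r → TDiv := fun n =>
    divZ r a (n * (a : ZMod r)) - divZ r a (n * (a : ZMod r) + 1) with hf
  have hX : ∀ j, divX r a j = divE₁ +
      ∑ k ∈ Finset.range (j * (a : ZMod r)⁻¹).val, f ((k + 1 : ℕ) : ZMod r) := fun j => rfl
  obtain ⟨n, rfl⟩ : ∃ n : ZMod r, i = n * (a : ZMod r) :=
    ⟨i * (a : ZMod r)⁻¹, by rw [mul_assoc, mul_comm _ (a : ZMod r), hab, mul_one]⟩
  have h1 : n * (a : ZMod r) * (a : ZMod r)⁻¹ = n := by rw [mul_assoc, hab, mul_one]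
  have h2 : (n * (a : ZMod r) - (a : ZMod r)) * (a : ZMod r)⁻¹ = n - 1 := by
    rw [sub_mul, h1, hab]
  have key : divX r a (n * (a : ZMod r)) = divX r a (n * (a : ZMod r) - a) + f n := by
    rw [hX, hX, h1, h2]
    obtain ⟨q, hq⟩ : ∃ q, r = q + 1 := Nat.exists_eq_succ_of_ne_zero (NeZero.ne r)
    by_cases hn : n = 0
    · have hv : ((0 : ZMod r) - 1).val = q := by
        subst hq
        rw [zero_sub, ZMod.val_neg_one]
      have htot : ∑ k ∈ Finset.range r, f ((k + 1 : ℕ) : ZMod r) = 0 := by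
        have hsum : ∀ g : ZMod r → TDiv,
            ∑ k ∈ Finset.range r, g (k : ZMod r) = ∑ x : ZMod r, g x := by
          intro g
          refine Finset.sum_bij' (fun k _ => (k : ZMod r)) (fun x _ => x.val) ?_ ?_ ?_ ?_ ?_
          · intro k _; exact Finset.mem_univ _
          · intro x _; exact Finset.mem_range.2 (ZMod.val_lt x)
          · intro k hk; exact ZMod.val_cast_of_lt (Finset.mem_range.1 hk)
          · intro x _; exact ZMod.natCast_zmod_val x
          · intro k _; rfl
        have e1 := hsum (fun x => f (x + 1))
        simp only [Nat.cast_add, Nat.cast_one]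
        rw [e1, show ∑ x, f (x + 1) = ∑ x, f x from Equiv.sum_comp (Equiv.addRight (1 : ZMod r)) f]
        simp only [hf, Finset.sum_sub_distrib]
        have hu : (a : ZMod r)⁻¹ * (a : ZMod r) = 1 := by rw [mul_comm, hab]
        let e : ZMod r ≃ ZMod r :=
          { toFun := fun x => x * (a : ZMod r)
            invFun := fun x => x * (a : ZMod r)⁻¹
            left_inv := fun x => by simp only [mul_assoc, hab, mul_one]
            right_inv := fun x => by simp only [mul_assoc, hu, mul_one] }
        rw [sub_eq_zero]
        exact (Equiv.sum_comp e (divZ r a)).trans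
          (Equiv.sum_comp (e.trans (Equiv.addRight (1 : ZMod r))) (divZ r a)).symm
      have hr0 : ((q + 1 : ℕ) : ZMod r) = 0 := by rw [← hq]; exact ZMod.natCast_self r
      have htot' : ∑ k ∈ Finset.range q, f ((k + 1 : ℕ) : ZMod r) + f 0 = 0 := by
        rw [← hr0, ← Finset.sum_range_succ (fun k => f ((k + 1 : ℕ) : ZMod r)) q, ← hq]
        exact htot
      rw [hn, hv, add_assoc, htot', ZMod.val_zero, Finset.sum_range_zero]
    · have hpos : 0 < n.val := Nat.pos_of_ne_zero (fun h0 => hn ((ZMod.val_eq_zero n).1 h0))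
      obtain ⟨t, ht⟩ := Nat.exists_eq_succ_of_ne_zero hpos.ne'
      have hlt : t + 1 < r := by have := ZMod.val_lt n; omega
      have hnt : n = ((t + 1 : ℕ) : ZMod r) := by
        rw [← Nat.succ_eq_add_one, ← ht, ZMod.natCast_zmod_val]
      have hv : (n - 1).val = t := by
        rw [hnt, Nat.cast_add, Nat.cast_one, add_sub_cancel_right,
          ZMod.val_cast_of_lt (by omega)]
      rw [ht, hv, Nat.succ_eq_add_one, Finset.sum_range_succ, ← hnt, add_assoc]
  rw [key, add_assoc, show f n + divZ r a (n * (a : ZMod r) + 1) = divZ r a (n * (a : ZMod r)) from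
    sub_add_cancel _ _, add_comm]

theorem divX_unique (r a : ℕ) [NeZero r] (h : Nat.Coprime r a) (X : ZMod r → TDiv)
    (h0 : X 0 = divE₁)
    (hX : ∀ i, X i + divZ r a (i + 1) = divZ r a i + X (i - (a : ZMod r))) : X = divX r a := by
  have hab : (a : ZMod r) * (a : ZMod r)⁻¹ = 1 := ZMod.coe_mul_inv_eq_one a h.symm
  have key : ∀ n : ℕ, X ((n : ZMod r) * a) = divX r a ((n : ZMod r) * a) := by
    intro n
    induction n with
    | zero => simp [h0, divX_zero]
    | succ n ih =>
      have e : ((n + 1 : ℕ) : ZMod r) * (a : ZMod r) - a = (n : ZMod r) * a := by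
        push_cast; ring
      have e1 := hX (((n + 1 : ℕ) : ZMod r) * a)
      have e2 := divX_add r a h (((n + 1 : ℕ) : ZMod r) * a)
      rw [e] at e1 e2
      rw [ih, ← e2] at e1
      exact add_right_cancel e1
  funext i
  have := key (i * (a : ZMod r)⁻¹).val
  rwa [ZMod.natCast_zmod_val, mul_assoc, mul_comm _ (a : ZMod r), hab, mul_one] at this

/-! ### The family of representations on the Danilov resolution -/

/-- The divisor attached to an arrow of the McKay quiver. -/
def arrowDivisor {r a : ℕ} : {i j : ZMod r} → McKayArrow r a i j → TDiv
  | _, _, .x i => divX r a i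
  | _, _, .y i => divY r a i
  | _, _, .z i => divZ r a i

/-- `m` is a local equation of `D` on `U_σ`, i.e. `D` restricted to `U_σ` is the divisor of the
regular function `χ^m`: the order of `χ^m` along the divisor of the ray of `v` is `⟨m, v⟩`. -/
def IsLocalEquation {r a : ℕ} (σ : Triple) (D : TDiv) (m : dualMonoid r a σ.cone) : Prop :=
  ∀ k : Fin 3, m.1 ⬝ᵥ σ k = (D (σ k) : ℝ)

open scoped Classical in
/-- The value at the point `s` of `U_σ` of the natural section `1` of `O(D)`, with respect to the
local generator `χ^{-m}` of `O(D)` on `U_σ`, where `χ^m` is the local equation of `D`. The local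
equation is unique and, as `U_σ` is smooth, it exists for all effective `D`, in particular for all
`X_i`, `Y_i` and `Z_i`. -/
def naturalSection {r a : ℕ} (σ : Triple) (s : Chart r a σ.cone) (D : TDiv) : ℂ :=
  if h : ∃ m : dualMonoid r a σ.cone, IsLocalEquation σ D m then s.character h.choose else 0

/-- The representation of the McKay quiver (with dimension vector `1`) in the family `F(r,a)` at
the point `s` of `U_σ`: each arrow acts by the value at `s` of the natural section of its line
bundle `O(X_i)`, `O(Y_i)` or `O(Z_i)`. -/
def chartRep {r a : ℕ} (σ : Triple) (s : Chart r a σ.cone) :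
    Rep (McKayQuiver r a) (fun _ => 1) :=
  fun _ _ (f : McKayArrow r a _ _) => naturalSection σ s (arrowDivisor f) • LinearMap.id

/-- `V` is (isomorphic to) the representation in the family `F(r,a)` at the point `y` of the
Danilov resolution, computed in some chart containing `y`. -/
def IsFamilyRep {r a : ℕ} (y : Resolution r a) (V : Rep (McKayQuiver r a) (fun _ => 1)) : Prop :=
  ∃ x : ChartPoint r a, Quot.mk (Glue r a) x = y ∧ Rep.Isomorphic (chartRep x.1.1 x.2) V

/-- The representation `F_i` at the torus fixed point of `U_{σ_i}`
(see `isTorusFixed_topCone_iff`). -/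
def topRep (r a i : ℕ) : Rep (McKayQuiver r a) (fun _ => 1) :=
  chartRep (topCone r a i) (torusFixedPoint r a (topCone r a i).cone)

end Danilov

end

/-!
A subrepresentation of a representation of dimension vector `(1, …, 1)` is determined by its
support, a set of vertices closed under the arrows that act by a non-zero scalar. On a chart `U_σ`
an arrow acts by a non-zero scalar at least where its divisor contains no divisor of a ray of `σ`,
and at the torus fixed point exactly there. So it suffices to show that a set `S` of vertices that
is closed under these arrows for *some* cone `σ` of the fan is closed under them for one of the
cones `σ_l` (`ArrowClosed.exists_topCone`): the subrepresentation with support `S` then has the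
same dimension vector as a subrepresentation of `F_l`, and the inequality for `θ` carries over.

At the fixed point of `U_{σ_l}` all `x_i` vanish, `y_{v-a}` is non-zero iff `τ(v) < l`, and `z_v`
is non-zero iff `l < τ(v)`. Hence `S` is closed for `σ_l` iff `τ(v) ≤ l` whenever `v ∈ S` and `v - a ∉ S`, and
`l ≤ τ(w)` whenever `w - a ∈ S` and `w ∉ S`. Such an `l` exists iff `τ(v) ≤ τ(w)` for all such `v`
and `w`. If a cone does not contain `e₁`, it is spanned by three points `p_κ`, `κ ∈ K`. There
closedness of `S` under the arrows `y` and `z` gives `τ(v) < max K` and `min K ≤ τ(w)`, and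
`τ(w) < τ(v)` is then excluded by a path of non-zero arrows `x` from `v` to `w` or from `w - a`
to `v - a` (`HasXPaths`).

The paths are found by recursion along the construction of the fan. For the central cone
`⟨e₂, e₃, p_{r-a}⟩` all arrows `x_0, …, x_{r-2}` are non-zero. For the cones in the images of `L`
and `R`, the orders of `X_i` along the `D_k`, for `i ≠ r - 1`, depend only on `i` modulo `r - a`,
respectively modulo `a`, and agree with those of the smaller singularity, because both solve the
same system of equations (`IsSolution.left`, `IsSolution.right`). So paths of arrows `x` in the
smaller McKay quiver lift (`HasXPaths.left`, `HasXPaths.right`).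
-/

namespace Danilov

/-! ### The recursion for `τ` -/

theorem lnr_natCast (s t : ℕ) : lnr s t = s % t := by
  unfold lnr
  rw [← Int.natCast_mod, Int.toNat_natCast]

theorem lnr_lt (s : ℤ) {t : ℕ} (ht : 0 < t) : lnr s t < t := by
  unfold lnr
  have h := Int.emod_lt_of_pos s (Int.natCast_pos.2 ht)
  have h' := Int.emod_nonneg s (Int.natCast_pos.2 ht).ne'
  omega

theorem lnr_neg_add_mod (r : ℕ) {a : ℕ} (ha : 0 < a) : (lnr (-r) a + r) % a = 0 := by
  unfold lnr
  have h' := Int.emod_nonneg (-(r : ℤ)) (Int.natCast_pos.2 ha).ne'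
  zify
  rw [Int.toNat_of_nonneg h', Int.emod_add_emod, neg_add_cancel, Int.zero_emod]

theorem coprime_left {r a : ℕ} (har : a < r) (h : Nat.Coprime r a) :
    Nat.Coprime (r - a) (r % (r - a)) := by
  have h1 : Nat.Coprime r (r - a) := (Nat.coprime_self_sub_right har.le).2 h
  rwa [Nat.Coprime, Nat.gcd_comm, ← Nat.gcd_rec, Nat.gcd_comm]

theorem coprime_right {r a : ℕ} (ha : 0 < a) (h : Nat.Coprime r a) :
    Nat.Coprime a (lnr (-r) a) := by
  refine Nat.coprime_of_dvd' fun d _ hd hd' => ?_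
  have h1 : d ∣ lnr (-r) a + r := hd.trans (Nat.dvd_of_mod_eq_zero (lnr_neg_add_mod r ha))
  rw [← h]
  exact Nat.dvd_gcd ((Nat.dvd_add_right hd').1 h1) hd

theorem tau_of_base {r a : ℕ} (i : ℕ) (h : a = 1 ∨ a + 1 = r) : tau r a i = lnr (a * i - 1) r := by
  rw [tau, if_pos h]

theorem tau_one (i : ℕ) : tau 1 0 i = 0 := by
  rw [tau_of_base i (Or.inr rfl)]
  exact Nat.lt_one_iff.1 (lnr_lt _ one_pos)

theorem lnr_eq {s : ℤ} {t u : ℕ} (q : ℤ) (hu : u < t) (h : s = u + t * q) : lnr s t = u := by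
  unfold lnr
  rw [h, Int.add_mul_emod_self_left, Int.emod_eq_of_lt (by omega) (by omega), Int.toNat_natCast]

/-- The recursion of `τ` on `i ≥ a`, which the closed formula for `a ∈ {1, r - 1}` also obeys. -/
theorem tau_of_le {r a i : ℕ} (ha : 0 < a) (har : a < r) (hi : i < r) (hai : a ≤ i) :
    tau r a i = tau (r - a) (r % (r - a)) (i % (r - a)) := by
  by_cases h : a = 1 ∨ a + 1 = r
  · rw [tau_of_base i h]
    by_cases hr : a + 1 = r
    · obtain rfl : i = a := by omega
      have : r - i = 1 := by omega
      rw [this, Nat.mod_one, tau_one]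
      refine lnr_eq (i - 1) (by omega) ?_
      rw [← hr]; push_cast; ring
    · obtain rfl : a = 1 := by omega
      have h1 : r % (r - 1) = 1 := by
        rw [Nat.mod_eq_sub_mod (by omega), Nat.sub_sub_self (by omega), Nat.mod_eq_of_lt (by omega)]
      rw [h1, tau_of_base _ (Or.inl rfl), lnr_eq 0 (u := i - 1) (by omega) (by push_cast; omega)]
      rcases Nat.lt_or_ge i (r - 1) with h2 | h2
      · rw [Nat.mod_eq_of_lt h2, lnr_eq 0 (u := i - 1) (by omega) (by push_cast; omega)]
      · obtain rfl : i = r - 1 := by omega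
        rw [Nat.mod_self, lnr_eq (-1) (u := r - 1 - 1) (by omega) (by push_cast; omega)]
  · rw [tau, if_neg h, dif_pos ⟨ha, har⟩, if_pos hai, lnr_natCast, lnr_natCast]

/-- The recursion of `τ` on `i < a`, which the closed formula for `a ∈ {1, r - 1}` also obeys. -/
theorem tau_of_lt {r a i : ℕ} (har : a < r) (hai : i < a) :
    tau r a i = (r - a) + tau a (lnr (-r) a) i := by
  by_cases h : a = 1 ∨ a + 1 = r
  · rw [tau_of_base i h]
    by_cases h1 : a = 1
    · subst h1
      obtain rfl : i = 0 := by omega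
      have h2 : lnr (-r) 1 = 0 := Nat.lt_one_iff.1 (lnr_lt _ one_pos)
      rw [h2, tau_one, lnr_eq (-1) (u := r - 1 + 0) (by omega) (by push_cast; omega)]
    · obtain rfl : r = a + 1 := by omega
      have h2 : lnr (-(a + 1 : ℕ)) a = a - 1 :=
        lnr_eq (-2) (by omega) (by push_cast; omega)
      rw [h2, tau_of_base _ (Or.inr (by omega)), lnr_eq (i - 1) (u := a - i) (by omega)
        (by push_cast [Nat.cast_sub hai.le]; ring),
        lnr_eq (i - 1) (u := a - 1 - i) (by omega) (by
          have : ((a - 1 - i : ℕ) : ℤ) = a - 1 - i := by omega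
          rw [this]
          push_cast [Nat.cast_sub (show 1 ≤ a by omega)]; ring)]
      omega
  · rw [tau, if_neg h, dif_pos ⟨by omega, har⟩, if_neg (by omega)]

theorem tau_lt {r : ℕ} : ∀ {a i : ℕ}, a < r → Nat.Coprime r a → i < r → tau r a i < r := by
  induction r using Nat.strong_induction_on with
  | _ r ih =>
    intro a i har hra hi
    rcases Nat.eq_zero_or_pos a with rfl | ha
    · obtain rfl : r = 1 := (Nat.coprime_zero_right r).1 hra
      rw [tau_one]; exact one_pos
    · have hn : 0 < r - a := by omega
      rcases Nat.lt_or_ge i a with hai | hai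
      · have := ih a har (lnr_lt (-r) ha) (coprime_right ha hra) hai
        rw [tau_of_lt har hai]; omega
      · have := ih (r - a) (by omega) (Nat.mod_lt _ hn) (coprime_left har hra) (Nat.mod_lt i hn)
        rw [tau_of_le ha har hi hai]; omega

/-! ### Orders of the divisors `X_i` and `Z_i` along `D_k` -/

/-- The order of `Z_v` along `D_k`, for a natural number `v` read modulo `r`. -/
def zOrd (r a k v : ℕ) : ℤ := if tau r a (v % r) < k then 1 else 0

theorem zOrd_congr {r u v : ℕ} (a k : ℕ) (h : u % r = v % r) : zOrd r a k u = zOrd r a k v := by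
  rw [zOrd, zOrd, h]

/-- `f` solves the equations `X_i + Z_{i+1} = Z_i + X_{i-a}`, `X_0 = 0`, for the orders of the
divisors `X_i` along `D_k`. -/
structure IsSolution (r a k : ℕ) (f : ℕ → ℤ) : Prop where
  periodic : Function.Periodic f r
  zero : f 0 = 0
  rel : ∀ i, f (i + a) + zOrd r a k (i + a + 1) = zOrd r a k (i + a) + f i

theorem eq_zero_of_periodic {r a : ℕ} (hr : 0 < r) (hra : Nat.Coprime r a) {g : ℕ → ℤ}
    (hg : Function.Periodic g r) (hg' : Function.Periodic g a) (h0 : g 0 = 0) (i : ℕ) :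
    g i = 0 := by
  have : NeZero r := ⟨hr.ne'⟩
  set n := ((i : ZMod r) * (a : ZMod r)⁻¹).val with hn
  have h1 : ((n * a : ℕ) : ZMod r) = (i : ZMod r) := by
    rw [Nat.cast_mul, hn, ZMod.natCast_zmod_val, mul_assoc, mul_comm _ (a : ZMod r),
      ZMod.coe_mul_inv_eq_one a hra.symm, mul_one]
  have h2 : (n * a) % r = i % r := (ZMod.natCast_eq_natCast_iff' _ _ _).1 h1
  rw [← hg.map_mod_nat i, ← h2, hg.map_mod_nat, ← h0]
  simpa using hg'.nat_mul n 0

namespace IsSolution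

variable {r a k : ℕ} {f g : ℕ → ℤ}

theorem unique (hr : 0 < r) (hra : Nat.Coprime r a) (hf : IsSolution r a k f)
    (hg : IsSolution r a k g) (i : ℕ) : f i = g i := by
  refine sub_eq_zero.1 (eq_zero_of_periodic hr hra (g := fun i => f i - g i) ?_ ?_ ?_ i)
  · intro i; simp only [hf.periodic i, hg.periodic i]
  · intro i; linarith [hf.rel i, hg.rel i]
  · simp only [hf.zero, hg.zero, sub_zero]

/-- The relation at the vertex `i`, whose predecessor is `i - a ≡ i + (r - a)`. -/
theorem rel_sub (hf : IsSolution r a k f) (har : a ≤ r) (i : ℕ) :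
    f i + zOrd r a k (i + 1) = zOrd r a k i + f (i + (r - a)) := by
  have h := hf.rel (i + (r - a))
  have e : i + (r - a) + a = i + r := by omega
  rw [e, hf.periodic i, zOrd_congr (u := i + r) a k (v := i) (by simp),
    zOrd_congr (u := i + r + 1) a k (v := i + 1)
      (by rw [Nat.add_right_comm, Nat.add_mod_right])] at h
  exact h

end IsSolution

section Left

variable {r a k : ℕ} {f : ℕ → ℤ}

theorem zOrd_left_eq_zero (har : a < r) (hk : k ≤ r - a) {v : ℕ} (hv : v < a) :
    zOrd r a k v = 0 := by
  rw [zOrd, Nat.mod_eq_of_lt (hv.trans har), tau_of_lt har hv, if_neg (by omega)]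

theorem zOrd_left (ha : 0 < a) {v : ℕ} (hav : a ≤ v) (hv : v < r) :
    zOrd r a k v = zOrd (r - a) (r % (r - a)) k v := by
  rw [zOrd, zOrd, Nat.mod_eq_of_lt hv, tau_of_le ha (hav.trans_lt hv) hv hav]

theorem IsSolution.mod_left (hf : IsSolution r a k f) (har : a < r) (hk : k ≤ r - a) (i : ℕ)
    (hi : i + 1 < r) : f i = f (i % (r - a)) := by
  induction i using Nat.strong_induction_on with
  | _ i ih =>
    rcases Nat.lt_or_ge i (r - a) with h | h
    · rw [Nat.mod_eq_of_lt h]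
    · obtain ⟨j, rfl⟩ := Nat.exists_eq_add_of_le' h
      have h1 := hf.rel_sub har.le j
      rw [zOrd_left_eq_zero har hk (v := j) (by omega),
        zOrd_left_eq_zero har hk (v := j + 1) (by omega)] at h1
      rw [Nat.add_mod_right, ← ih j (by omega) (by omega)]
      linarith

theorem IsSolution.left (hf : IsSolution r a k f) (ha : 0 < a) (har : a < r) (hk : k ≤ r - a) :
    IsSolution (r - a) (r % (r - a)) k (fun j => f (j % (r - a))) where
  periodic j := by simp only [Nat.add_mod_right]
  zero := by simp only [Nat.zero_mod, hf.zero]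
  rel j' := by
    -- The vertex `j'` is moved to its representative `j < r - a`, and `j + r % (r - a)` to
    -- the representative `j + a` of its class in `[a, r)`.
    set j := j' % (r - a) with hj
    have hjn : j < r - a := Nat.mod_lt _ (by omega)
    have e0 : ∀ t, (j' + r % (r - a) + t) % (r - a) = (j + a + t) % (r - a) := by
      intro t
      have hra : r ≡ a [MOD r - a] := by
        have : r = a + (r - a) := by omega
        conv_lhs => rw [this]
        exact Nat.add_mod_right _ _
      exact (((Nat.mod_modEq j' (r - a)).symm).add ((Nat.mod_modEq r _).trans hra)).add_right t
    have e1 := e0 0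
    simp only [add_zero] at e1
    rw [e1, zOrd_congr _ _ (e0 1), zOrd_congr _ _ e1, ← zOrd_left ha (v := j + a) (by omega)
      (by omega)]
    rcases Nat.lt_or_ge (j + a + 1) r with h | h
    · rw [← hf.mod_left har hk _ h, ← zOrd_left ha (by omega) h]
      exact hf.rel j
    · have h1 := hf.rel j
      have h2 := hf.rel_sub har.le (a - 1)
      have e2 : j + a + 1 = r := by omega
      have e3 : a - 1 + (r - a) = j + a := by omega
      have e4 : (j + a) % (r - a) = (a - 1) % (r - a) := by rw [← e3, Nat.add_mod_right]
      have e5 : (j + a + 1) % (r - a) = a % (r - a) := by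
        rw [show j + a + 1 = a + (r - a) by omega, Nat.add_mod_right]
      rw [zOrd_congr a k (v := 0) (by rw [e2, Nat.mod_self, Nat.zero_mod]),
        zOrd_left_eq_zero har hk ha] at h1
      rw [e3, Nat.sub_add_cancel ha, zOrd_left_eq_zero har hk (v := a - 1) (by omega)] at h2
      rw [e4, ← hf.mod_left har hk (a - 1) (by omega), zOrd_congr _ _ e5,
        ← zOrd_left ha le_rfl har]
      linarith

end Left

section Right

variable {r a k : ℕ} {f : ℕ → ℤ}

theorem zOrd_right_eq_one (ha : 0 < a) (hra : Nat.Coprime r a) {v : ℕ} (hav : a ≤ v) (hv : v < r) :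
    zOrd r a (r - a + k) v = 1 := by
  have har := hav.trans_lt hv
  have hn : 0 < r - a := by omega
  have := tau_lt (Nat.mod_lt _ hn) (coprime_left har hra) (Nat.mod_lt v hn)
  rw [zOrd, Nat.mod_eq_of_lt hv, tau_of_le ha har hv hav, if_pos (by omega)]

theorem zOrd_right (har : a < r) {v : ℕ} (hv : v < a) :
    zOrd r a (r - a + k) v = zOrd a (lnr (-r) a) k v := by
  rw [zOrd, zOrd, Nat.mod_eq_of_lt hv, Nat.mod_eq_of_lt (hv.trans har), tau_of_lt har hv]
  simp only [Nat.add_lt_add_iff_left]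

theorem IsSolution.mod_right (hf : IsSolution r a (r - a + k) f) (ha : 0 < a)
    (hra : Nat.Coprime r a) (i : ℕ) (hi : i + 1 < r) : f i = f (i % a) := by
  induction i using Nat.strong_induction_on with
  | _ i ih =>
    rcases Nat.lt_or_ge i a with h | h
    · rw [Nat.mod_eq_of_lt h]
    · obtain ⟨j, rfl⟩ := Nat.exists_eq_add_of_le' h
      have h1 := hf.rel j
      rw [zOrd_right_eq_one ha hra (v := j + a) (by omega) (by omega),
        zOrd_right_eq_one ha hra (v := j + a + 1) (by omega) (by omega)] at h1
      rw [Nat.add_mod_right, ← ih j (by omega) (by omega)]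
      linarith

theorem IsSolution.right (hf : IsSolution r a (r - a + k) f) (ha : 0 < a) (har : a < r)
    (hra : Nat.Coprime r a) : IsSolution a (lnr (-r) a) k (fun j => f (j % a)) where
  periodic j := by simp only [Nat.add_mod_right]
  zero := by simp only [Nat.zero_mod, hf.zero]
  rel j := by
    -- The vertex `j + lnr (-r) a` is moved to its representative `i < a`, and `j` to
    -- the representative `i + (r - a)` of its class in `[r - a, r)`.
    set i := (j + lnr (-r) a) % a with hi
    have hia : i < a := Nat.mod_lt _ ha
    have e1 : (j + lnr (-r) a) % a = i % a := by rw [hi, Nat.mod_mod]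
    have e2 : (j + lnr (-r) a + 1) % a = (i + 1) % a := Nat.ModEq.add_right 1 e1
    have e3 : j % a = (i + (r - a)) % a := by
      have h1 : i + r ≡ j + lnr (-r) a + r [MOD a] := (Nat.mod_modEq _ _).add_right r
      have h2 : j + lnr (-r) a + r ≡ j + 0 [MOD a] := by
        rw [add_assoc]; exact Nat.ModEq.add_left j (lnr_neg_add_mod r ha)
      have h3 : i + r = i + (r - a) + a := by omega
      have h4 := h1.trans h2
      rw [h3, Nat.ModEq, Nat.add_mod_right] at h4
      exact h4.symm
    have h1 := hf.rel_sub har.le i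
    rw [zOrd_congr _ _ e2, zOrd_congr _ _ e1, e3, ← zOrd_right har hia]
    rcases Nat.lt_or_ge (i + 1) a with h | h
    · rw [← hf.mod_right ha hra (i + (r - a)) (by omega), ← zOrd_right har h]
      exact h1
    · clear_value i
      obtain rfl : i + 1 = a := by omega
      have h2 := hf.rel (r - (i + 1) - 1)
      have e4 : r - (i + 1) - 1 + (i + 1) + 1 = r := by omega
      have e5 : r - (i + 1) - 1 + (i + 1) = i + (r - (i + 1)) := by omega
      rw [e4, zOrd_congr (i + 1) _ (v := 0) (by simp), e5, zOrd_right har ha,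
        zOrd_right_eq_one ha hra (v := i + (r - (i + 1))) (by omega) (by omega)] at h2
      rw [zOrd_right_eq_one ha hra le_rfl har] at h1
      rw [zOrd_congr (r := i + 1) _ _ (v := 0) (by simp), ← e5, Nat.add_mod_right,
        ← hf.mod_right ha hra _ (by omega)]
      linarith

end Right

/-- Along `D_0 = E_2`, `D_{r-a}` and `D_r = E_3`, only `X_{r-1}` may have non-zero order. -/
theorem isSolution_central {r a : ℕ} (ha : 0 < a) (har : a < r) (hra : Nat.Coprime r a) {k : ℕ}
    (hk : k = 0 ∨ k = r - a ∨ k = r) :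
    IsSolution r a k (fun i => if k = r - a ∧ i % r = r - 1 then 1 else 0) where
  periodic i := by simp only [Nat.add_mod_right]
  zero := by rw [Nat.zero_mod, if_neg (by omega)]
  rel i := by
    have hr : 0 < r := by omega
    rcases hk with rfl | rfl | rfl
    · simp only [zOrd, Nat.not_lt_zero, if_false]
      rw [if_neg (by omega), if_neg (by omega)]
    · have hz : ∀ v, zOrd r a (r - a) v = if a ≤ v % r then 1 else 0 := by
        intro v
        have hv := Nat.mod_lt v hr
        split_ifs with h
        · rw [zOrd_congr a _ (Nat.mod_mod v r).symm]
          exact zOrd_right_eq_one (k := 0) ha hra h hv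
        · rw [zOrd_congr a _ (Nat.mod_mod v r).symm]
          exact zOrd_left_eq_zero har le_rfl (by omega)
      have hj := Nat.mod_lt i hr
      have e1 : (i + a) % r = if i % r + a < r then i % r + a else i % r + a - r := by
        rw [← Nat.mod_add_mod]
        split_ifs with h
        · exact Nat.mod_eq_of_lt h
        · rw [Nat.mod_eq_sub_mod (by omega), Nat.mod_eq_of_lt (by omega)]
      have hj' := Nat.mod_lt (i + a) hr
      have e2 : (i + a + 1) % r = if (i + a) % r + 1 < r then (i + a) % r + 1 else 0 := by
        rw [← Nat.mod_add_mod]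
        split_ifs with h
        · exact Nat.mod_eq_of_lt h
        · rw [show (i + a) % r + 1 = r by omega, Nat.mod_self]
      rw [hz, hz, e2, e1]
      split_ifs <;> first | rfl | omega
    · have hz : ∀ v, zOrd k a k v = 1 := fun v =>
        if_pos (tau_lt har hra (Nat.mod_lt v hr))
      rw [hz, hz, if_neg (by omega), if_neg (by omega), add_comm]

/-! ### The points `p_i` and the maps `L` and `R` -/

theorem p_zero (r a k : ℕ) :
    p r a k 0 = (r : ℝ)⁻¹ * ((-((k : ZMod r) * (a : ZMod r)⁻¹)).val : ℝ) := rfl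

theorem p_one (r a k : ℕ) : p r a k 1 = (r : ℝ)⁻¹ * ((r : ℝ) - k) := rfl

theorem p_two (r a k : ℕ) : p r a k 2 = (r : ℝ)⁻¹ * k := rfl

theorem p_injective {r : ℕ} (hr : 0 < r) (a : ℕ) : Function.Injective (p r a) := by
  intro k l h
  have h2 := congrFun h 2
  rw [p_two, p_two] at h2
  have hr' : (r : ℝ)⁻¹ ≠ 0 := inv_ne_zero (Nat.cast_ne_zero.2 hr.ne')
  exact_mod_cast mul_left_cancel₀ hr' h2

theorem p_ne_e₁ {r : ℕ} (hr : 0 < r) (a k : ℕ) : p r a k ≠ e₁ := by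
  intro h
  have h1 := congrFun h 1
  have h2 := congrFun h 2
  rw [p_one] at h1
  rw [p_two] at h2
  have hr' : (r : ℝ) ≠ 0 := Nat.cast_ne_zero.2 hr.ne'
  have e1 : e₁ 1 = 0 := rfl
  have e2 : e₁ 2 = 0 := rfl
  rw [e1] at h1
  rw [e2] at h2
  field_simp at h1 h2
  have h3 : (k : ℝ) = 0 := by linarith
  rw [h3] at h1
  exact hr' (by linarith)

theorem mul_inv_cast {r a : ℕ} (hra : Nat.Coprime r a) : (a : ZMod r) * (a : ZMod r)⁻¹ = 1 :=
  ZMod.coe_mul_inv_eq_one a hra.symm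

/-- The first coordinate of `r p_k` is the only `α < r` with `aα + k ≡ 0` modulo `r`. -/
theorem val_eq_of_dvd {r a k α : ℕ} (hra : Nat.Coprime r a) (hα : α < r) (h : r ∣ a * α + k) :
    (-((k : ZMod r) * (a : ZMod r)⁻¹)).val = α := by
  have h0 : ((a * α + k : ℕ) : ZMod r) = 0 := (ZMod.natCast_eq_zero_iff _ _).2 h
  push_cast at h0
  have h1 : -((k : ZMod r) * (a : ZMod r)⁻¹) = α := by
    rw [eq_neg_of_add_eq_zero_right h0, neg_mul, neg_neg, mul_right_comm, mul_inv_cast hra, one_mul]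
  rw [h1, ZMod.val_cast_of_lt hα]

theorem dvd_mul_val_add {r a : ℕ} (hr : 0 < r) (hra : Nat.Coprime r a) (k : ℕ) :
    r ∣ a * (-((k : ZMod r) * (a : ZMod r)⁻¹)).val + k := by
  have : NeZero r := ⟨hr.ne'⟩
  rw [← ZMod.natCast_eq_zero_iff]
  push_cast
  rw [ZMod.natCast_zmod_val, mul_neg, mul_left_comm, mul_inv_cast hra, mul_one, neg_add_cancel]

theorem val_lt' {r : ℕ} (hr : 0 < r) (x : ZMod r) : x.val < r := by
  have : NeZero r := ⟨hr.ne'⟩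
  exact ZMod.val_lt x

theorem p_sub {r a : ℕ} (ha : 0 < a) (har : a < r) (hra : Nat.Coprime r a) :
    p r a (r - a) = (r : ℝ)⁻¹ • ![1, (a : ℝ), (r : ℝ) - a] := by
  rw [p, val_eq_of_dvd hra (α := 1) (by omega) ⟨1, by omega⟩, Nat.cast_sub har.le]
  simp

theorem mapL_e₁ (r a : ℕ) : mapL r a e₁ = e₁ := by simp [mapL, e₁]

theorem mapR_e₁ (r a : ℕ) : mapR r a e₁ = e₁ := by simp [mapR, e₁]

/-- The map `L` carries the points `p_k` of `1/(r-a) (1, r, -r)` to `p_0, …, p_{r-a}`. -/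
theorem mapL_p {r a k : ℕ} (ha : 0 < a) (har : a < r) (hra : Nat.Coprime r a) (hk : k ≤ r - a) :
    mapL r a (p (r - a) (r % (r - a)) k) = p r a k := by
  have hn : 0 < r - a := by omega
  set α := (-((k : ZMod (r - a)) * ((r % (r - a) : ℕ) : ZMod (r - a))⁻¹)).val with hα
  have hαn : α < r - a := val_lt' hn _
  have h1 : r - a ∣ r * α + k := by
    have := dvd_mul_val_add hn (coprime_left har hra) k
    rw [← hα] at this
    rw [Nat.dvd_iff_mod_eq_zero] at this ⊢
    rw [← this]
    exact ((Nat.mod_modEq r (r - a)).symm.mul_right α).add_right k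
  obtain ⟨β, hβ⟩ := h1
  have hβr : β < r := by
    by_contra! hc
    have h2 : (r - a) * r ≤ (r - a) * β := Nat.mul_le_mul_left _ hc
    have h3 : r * (α + 1) ≤ r * (r - a) := Nat.mul_le_mul_left _ hαn
    rw [mul_comm r (r - a)] at h3
    rw [mul_add] at h3
    omega
  have h4 : (-((k : ZMod r) * (a : ZMod r)⁻¹)).val = β := by
    refine val_eq_of_dvd hra hβr ?_
    have : r ∣ a * β + (k + r * α) :=
      ⟨β, by rw [add_comm k, hβ, ← add_mul, Nat.add_sub_cancel' har.le]⟩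
    rw [← add_assoc] at this
    exact (Nat.dvd_add_left (dvd_mul_right r α)).1 this
  have hβ' : (r : ℝ) * α + k = (r - a) * β := by
    rw [← Nat.cast_sub har.le]; exact_mod_cast hβ
  have hr' : (r : ℝ) ≠ 0 := Nat.cast_ne_zero.2 (by omega)
  have hn' : (r : ℝ) - a ≠ 0 := by
    rw [← Nat.cast_sub har.le]; exact Nat.cast_ne_zero.2 hn.ne'
  rw [mapL, p_sub ha har hra, p_zero, p_one, p_two, ← hα, p, h4, Nat.cast_sub har.le]
  ext c
  fin_cases c
  · simp [e₁, e₂]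
    field_simp
    linarith
  · simp [e₁, e₂]
    field_simp
    ring
  · simp [e₁, e₂]
    field_simp

/-- The map `R` carries the points `p_k` of `1/a (1, -r, r)` to `p_{r-a}, …, p_r`. -/
theorem mapR_p {r a k : ℕ} (ha : 0 < a) (har : a < r) (hra : Nat.Coprime r a) (hk : k ≤ a) :
    mapR r a (p a (lnr (-r) a) k) = p r a (r - a + k) := by
  set α := (-((k : ZMod a) * ((lnr (-r) a : ℕ) : ZMod a)⁻¹)).val with hα
  have hαn : α < a := val_lt' ha _
  have h1 : a ∣ r * α + (a - k) := by
    have h := dvd_mul_val_add ha (coprime_right ha hra) k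
    rw [← hα] at h
    have h' : a ∣ (lnr (-r) a + r) * α :=
      (Nat.dvd_of_mod_eq_zero (lnr_neg_add_mod r ha)).mul_right α
    have h'' : a ∣ (lnr (-r) a * α + k) + (r * α + (a - k)) := by
      have e : (lnr (-r) a * α + k) + (r * α + (a - k)) = (lnr (-r) a + r) * α + a := by
        rw [add_mul]; omega
      rw [e]
      exact h'.add (dvd_refl a)
    exact (Nat.dvd_add_right h).1 h''
  obtain ⟨β, hβ⟩ := h1
  have hβr : β < r := by
    by_contra! hc
    have h2 : a * r ≤ a * β := Nat.mul_le_mul_left _ hc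
    have h3 : r * (α + 1) ≤ r * a := Nat.mul_le_mul_left _ hαn
    rw [mul_comm r a] at h3
    rw [mul_add] at h3
    omega
  have h4 : (-(((r - a + k : ℕ) : ZMod r) * (a : ZMod r)⁻¹)).val = β := by
    refine val_eq_of_dvd hra hβr ⟨α + 1, ?_⟩
    rw [← hβ, mul_add]
    omega
  have hβ' : (r : ℝ) * α + (a - k) = a * β := by
    rw [← Nat.cast_sub hk]; exact_mod_cast hβ
  have hr' : (r : ℝ) ≠ 0 := Nat.cast_ne_zero.2 (by omega)
  have ha' : (a : ℝ) ≠ 0 := Nat.cast_ne_zero.2 ha.ne'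
  rw [mapR, p_sub ha har hra, p_zero, p_one, p_two, ← hα, p, h4, Nat.cast_add,
    Nat.cast_sub har.le]
  ext c
  fin_cases c
  · simp [e₁, e₃]
    field_simp
    linarith
  · simp [e₁, e₃]
    field_simp
    ring
  · simp [e₁, e₃]
    field_simp
    ring

/-! ### The divisors on the rays of the fan -/

section Orders

variable {r : ℕ} (a : ℕ)

theorem divZ_apply_p (hr : 0 < r) {k : ℕ} (hk : k ≤ r) (i : ZMod r) :
    divZ r a i (p r a k) = if tau r a i.val < k then 1 else 0 := by
  have h : ∀ l, divD r a l (p r a k) = if l = k then 1 else 0 := fun l => by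
    rw [divD, Finsupp.single_apply]
    simp only [(p_injective hr a).eq_iff]
  simp only [divZ, Finsupp.finsetSum_apply, h, Finset.sum_ite_eq', Finset.mem_Icc, hk, and_true,
    Nat.succ_le_iff]

theorem divY_apply_p (hr : 0 < r) (k : ℕ) (i : ZMod r) :
    divY r a i (p r a k) = if k ≤ tau r a (i + (a : ZMod r)).val then 1 else 0 := by
  have h : ∀ l, divD r a l (p r a k) = if l = k then 1 else 0 := fun l => by
    rw [divD, Finsupp.single_apply]
    simp only [(p_injective hr a).eq_iff]
  simp only [divY, Finsupp.finsetSum_apply, h, Finset.sum_ite_eq', Finset.mem_Icc, zero_le,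
    true_and]

theorem divD_apply_e₁ (hr : 0 < r) (k : ℕ) : divD r a k e₁ = 0 :=
  Finsupp.single_eq_of_ne' (p_ne_e₁ hr a k)

theorem divZ_apply_e₁ (hr : 0 < r) (i : ZMod r) : divZ r a i e₁ = 0 := by
  simp only [divZ, Finsupp.finsetSum_apply, divD_apply_e₁ a hr, Finset.sum_const_zero]

theorem divX_apply_e₁ (hr : 0 < r) (i : ZMod r) : divX r a i e₁ = 1 := by
  simp only [divX, Finsupp.add_apply, Finsupp.finsetSum_apply, Finsupp.sub_apply,
    divZ_apply_e₁ a hr, sub_zero, Finset.sum_const_zero, add_zero, divE₁, Finsupp.single_eq_same]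

end Orders

/-- The order of `X_i` along `D_k`, for a natural number `i` read modulo `r`. -/
noncomputable def xOrd (r a k i : ℕ) : ℤ := divX r a (i : ZMod r) (p r a k)

theorem isSolution_xOrd {r a k : ℕ} (hr : 0 < r) (hra : Nat.Coprime r a) (hk : k ≤ r) :
    IsSolution r a k (xOrd r a k) where
  periodic i := by simp only [xOrd, Nat.cast_add, ZMod.natCast_self, add_zero]
  zero := by
    rw [xOrd, Nat.cast_zero, divX_zero, divE₁]
    exact Finsupp.single_eq_of_ne (p_ne_e₁ hr a k)
  rel i := by
    have : NeZero r := ⟨hr.ne'⟩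
    have hz : ∀ v : ℕ, zOrd r a k v = divZ r a (v : ZMod r) (p r a k) := fun v => by
      rw [divZ_apply_p a hr hk, ZMod.val_natCast, zOrd]
    have h := DFunLike.congr_fun (divX_add r a hra ((i + a : ℕ) : ZMod r)) (p r a k)
    rw [Finsupp.add_apply, Finsupp.add_apply] at h
    have e : ((i + a : ℕ) : ZMod r) - a = i := by push_cast; ring
    rw [e] at h
    rw [hz, hz, xOrd, xOrd, h.symm, Nat.cast_add (i + a) 1, Nat.cast_one]

theorem xOrd_left {r a k i : ℕ} (ha : 0 < a) (har : a < r) (hra : Nat.Coprime r a)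
    (hk : k ≤ r - a) (hi : i + 1 < r) :
    xOrd r a k i = xOrd (r - a) (r % (r - a)) k (i % (r - a)) := by
  have hf := isSolution_xOrd (a := a) (k := k) (by omega) hra (by omega)
  have hn : 0 < r - a := by omega
  have h := (hf.left ha har hk).unique hn (coprime_left har hra)
    (isSolution_xOrd hn (coprime_left har hra) hk) (i % (r - a))
  rw [← h, hf.mod_left har hk i hi, Nat.mod_mod]

theorem xOrd_right {r a k i : ℕ} (ha : 0 < a) (har : a < r) (hra : Nat.Coprime r a)
    (hk : k ≤ a) (hi : i + 1 < r) :
    xOrd r a (r - a + k) i = xOrd a (lnr (-r) a) k (i % a) := by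
  have hf := isSolution_xOrd (a := a) (k := r - a + k) (by omega) hra (by omega)
  have h := (hf.right ha har hra).unique ha (coprime_right ha hra)
    (isSolution_xOrd ha (coprime_right ha hra) hk) (i % a)
  rw [← h, hf.mod_right ha hra i hi, Nat.mod_mod]

theorem xOrd_central {r a k i : ℕ} (ha : 0 < a) (har : a < r) (hra : Nat.Coprime r a)
    (hk : k = 0 ∨ k = r - a ∨ k = r) (hi : i + 1 < r) : xOrd r a k i = 0 := by
  rw [(isSolution_xOrd (a := a) (k := k) (by omega) hra (by omega)).unique (by omega) hra
    (isSolution_central ha har hra hk) i, Nat.mod_eq_of_lt (by omega), if_neg (by omega)]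

/-! ### Paths of arrows `x_i` -/

/-- The arrows `x_u, …, x_{t-1}` form a path from `u` to `t` in `{0, …, r - 1}`, and none of them
vanishes on a divisor `D_κ` with `κ ∈ K`. -/
def XPath (r a : ℕ) (K : Set ℕ) (u t : ℕ) : Prop :=
  u ≤ t ∧ ∀ i, u ≤ i → i < t → ∀ κ ∈ K, xOrd r a κ i = 0

/-- The residue of `v - a` modulo `r`, for `v < r`. -/
def subMod (r a v : ℕ) : ℕ := if v < a then v + (r - a) else v - a

/-- The combinatorial property of the cones `⟨p_κ | κ ∈ K⟩` that do not contain `e₁`. At their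
fixed points, `y_{w-a}` vanishes if `min K ≤ τ(w)` and `z_v` vanishes if `τ(v) < max K`. If both
happen and `τ(w) < τ(v)`, then non-vanishing arrows `x` lead from `v` to `w` or from `w - a` to
`v - a`. The three cases record on which side of `a` the vertices lie and, where the recursion
needs it, both paths. -/
def HasXPaths (r a : ℕ) (K : Set ℕ) : Prop :=
  ∀ v < r, ∀ w < r, (∃ κ ∈ K, κ ≤ tau r a w) → tau r a w < tau r a v → (∃ κ ∈ K, tau r a v < κ) →
    ((v < a ↔ w < a) ∧ XPath r a K v w) ∨
    ((v < a ↔ w < a) ∧ w ≤ v ∧ XPath r a K (subMod r a w) (subMod r a v)) ∨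
    (v < a ∧ a ≤ w ∧ XPath r a K v w ∧ XPath r a K (subMod r a w) (subMod r a v))

section

variable {r a : ℕ}

theorem hasXPaths_central (ha : 0 < a) (har : a < r) (hra : Nat.Coprime r a) :
    HasXPaths r a {0, r - a, r} := by
  have hp : ∀ u t, u ≤ t → t < r → XPath r a {0, r - a, r} u t := fun u t hut ht =>
    ⟨hut, fun i _ hi κ hκ => xOrd_central ha har hra (by simpa using hκ) (by omega)⟩
  intro v hv w hw _ hvw _
  have hn : 0 < r - a := by omega
  rcases Nat.lt_or_ge v a with h1 | h1 <;> rcases Nat.lt_or_ge w a with h2 | h2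
  · rcases Nat.le_total v w with h | h
    · exact Or.inl ⟨by omega, hp _ _ h hw⟩
    · refine Or.inr (Or.inl ⟨by omega, h, hp _ _ ?_ ?_⟩) <;> unfold subMod <;> split_ifs <;> omega
  · refine Or.inr (Or.inr ⟨h1, h2, hp _ _ (by omega) hw, hp _ _ ?_ ?_⟩) <;> unfold subMod <;>
      split_ifs <;> omega
  · have := tau_lt (Nat.mod_lt _ hn) (coprime_left har hra) (Nat.mod_lt v hn)
    rw [tau_of_lt har h2, tau_of_le ha har hv h1] at hvw
    omega
  · rcases Nat.le_total v w with h | h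
    · exact Or.inl ⟨by omega, hp _ _ h hw⟩
    · refine Or.inr (Or.inl ⟨by omega, h, hp _ _ ?_ ?_⟩) <;> unfold subMod <;> split_ifs <;> omega

theorem add_mod_of_mod_eq {n u u' j : ℕ} (hu : u' % n = u) (hj : u + j < n) :
    (u' + j) % n = u + j := by
  rw [← Nat.mod_add_mod, hu, Nat.mod_eq_of_lt hj]

/-- Paths of arrows `x` lift along `L` to translates by multiples of `r - a` inside `[0, r)`. -/
theorem XPath.left (ha : 0 < a) (har : a < r) (hra : Nat.Coprime r a) {K : Set ℕ}
    (hK : ∀ κ ∈ K, κ ≤ r - a) {u t u' t' : ℕ} (h : XPath (r - a) (r % (r - a)) K u t)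
    (htn : t < r - a) (ht : t' < r) (hu : u' % (r - a) = u) (hut : t' + u = t + u') :
    XPath r a K u' t' := by
  have h1 := h.1
  refine ⟨by omega, fun i hi hi' κ hκ => ?_⟩
  obtain ⟨j, rfl⟩ := Nat.exists_eq_add_of_le hi
  rw [xOrd_left ha har hra (hK κ hκ) (by omega), add_mod_of_mod_eq hu (by omega)]
  exact h.2 _ (by omega) (by omega) κ hκ

/-- Paths of arrows `x` lift along `R` to translates by multiples of `a` inside `[0, r)`. -/
theorem XPath.right (ha : 0 < a) (har : a < r) (hra : Nat.Coprime r a) {K : Set ℕ}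
    (hK : ∀ κ ∈ K, κ ≤ a) {u t u' t' : ℕ} (h : XPath a (lnr (-r) a) K u t)
    (hta : t < a) (ht : t' < r) (hu : u' % a = u) (hut : t' + u = t + u') :
    XPath r a ((fun κ => r - a + κ) '' K) u' t' := by
  have h1 := h.1
  refine ⟨by omega, ?_⟩
  rintro i hi hi' _ ⟨κ, hκ, rfl⟩
  obtain ⟨j, rfl⟩ := Nat.exists_eq_add_of_le hi
  rw [xOrd_right ha har hra (hK κ hκ) (by omega), add_mod_of_mod_eq hu (by omega)]
  exact h.2 _ (by omega) (by omega) κ hκ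

/-- The vertex `x = v - a` modulo `n`, together with the two cases `v ≥ a` and `v < a`. -/
theorem subMod_eq {n a x v : ℕ} (ha : a < n) (hx : x < n) (h : (x + a) % n = v) :
    subMod n a v = x ∧ (v = x + a ∧ a ≤ v ∨ v + n = x + a ∧ v < a) := by
  unfold subMod
  rcases Nat.lt_or_ge (x + a) n with h1 | h1
  · rw [Nat.mod_eq_of_lt h1] at h
    split_ifs <;> omega
  · rw [Nat.mod_eq_sub_mod h1, Nat.mod_eq_of_lt (by omega)] at h
    split_ifs <;> omega

/-- Here `v, w ≥ a`. A path to `w` lifts to the representatives in `[a, r)`,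
and a path from `w - a` to the representatives in `[0, r - a)`. -/
theorem HasXPaths.left (ha : 0 < a) (har : a < r) (hra : Nat.Coprime r a) {K : Set ℕ}
    (hK : ∀ κ ∈ K, κ ≤ r - a) (h : HasXPaths (r - a) (r % (r - a)) K) : HasXPaths r a K := by
  have hn : 0 < r - a := by omega
  rintro v hv w hw hw1 hvw ⟨κ, hκ, hv1⟩
  -- Since `τ(w), τ(v) < r - a`, both vertices are at least `a`.
  have hav : a ≤ v := by
    by_contra! hc
    have := hK κ hκ
    rw [tau_of_lt har hc] at hv1
    omega
  have haw : a ≤ w := by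
    by_contra! hc
    have := hK κ hκ
    rw [tau_of_lt har hc] at hvw
    omega
  have key : ∀ u, a ≤ u → u < r → subMod r a u = u - a ∧
      subMod (r - a) (r % (r - a)) (u % (r - a)) = u - a ∧
      (u % (r - a) = u - a + r % (r - a) ∧ r % (r - a) ≤ u % (r - a) ∨
        u % (r - a) + (r - a) = u - a + r % (r - a) ∧ u % (r - a) < r % (r - a)) := by
    intro u hu hur
    refine ⟨by rw [subMod, if_neg (by omega)], subMod_eq (Nat.mod_lt _ hn) (by omega) ?_⟩
    rw [Nat.add_mod_mod, show u - a + r = u + (r - a) by omega, Nat.add_mod_right]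
  obtain ⟨ev, ev', hv'⟩ := key v hav hv
  obtain ⟨ew, ew', hw'⟩ := key w haw hw
  have hvn := Nat.mod_lt v hn
  have hwn := Nat.mod_lt w hn
  rw [tau_of_le ha har hw haw] at hw1 hvw
  rw [tau_of_le ha har hv hav] at hvw hv1
  have hbottom : XPath (r - a) (r % (r - a)) K (w - a) (v - a) → XPath r a K (w - a) (v - a) :=
    fun hp => hp.left ha har hra hK (by omega) (by omega) (Nat.mod_eq_of_lt (by omega)) rfl
  rw [ev, ew]
  rcases h _ hvn _ hwn hw1 hvw ⟨κ, hκ, hv1⟩ with ⟨hs, hp⟩ | ⟨hs, hle, hp⟩ | ⟨h1, h2, hp, hp'⟩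
  · exact Or.inl ⟨by omega, hp.left ha har hra hK hwn hw rfl (by omega)⟩
  · rw [ev', ew'] at hp
    exact Or.inr (Or.inl ⟨by omega, by omega, hbottom hp⟩)
  · rw [ev', ew'] at hp'
    exact Or.inr (Or.inl ⟨by omega, by omega, hbottom hp'⟩)

/-- Here `v, w < a`. A path to `w` lifts to the representatives in
`[0, a)`, and a path from `w - a` to the representatives in `[r - a, r)`. -/
theorem HasXPaths.right (ha : 0 < a) (har : a < r) (hra : Nat.Coprime r a) {K : Set ℕ}
    (hK : ∀ κ ∈ K, κ ≤ a) (h : HasXPaths a (lnr (-r) a) K) :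
    HasXPaths r a ((fun κ => r - a + κ) '' K) := by
  have hn : 0 < r - a := by omega
  rintro v hv w hw ⟨_, ⟨κ, hκ, rfl⟩, hw1⟩ hvw ⟨_, ⟨κ', hκ', rfl⟩, hv1⟩
  -- Since `τ(w), τ(v) ≥ r - a`, both vertices are less than `a`.
  have haw : w < a := by
    by_contra! hc
    have := tau_lt (Nat.mod_lt _ hn) (coprime_left har hra) (Nat.mod_lt w hn)
    rw [tau_of_le ha har hw hc] at hw1
    dsimp only at hw1
    omega
  have hav : v < a := by
    by_contra! hc
    have := tau_lt (Nat.mod_lt _ hn) (coprime_left har hra) (Nat.mod_lt v hn)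
    rw [tau_of_le ha har hv hc] at hvw
    dsimp only at hw1
    omega
  have key : ∀ u < a, subMod r a u = u + (r - a) ∧
      subMod a (lnr (-r) a) u = (u + (r - a)) % a ∧
      (u = (u + (r - a)) % a + lnr (-r) a ∧ lnr (-r) a ≤ u ∨
        u + a = (u + (r - a)) % a + lnr (-r) a ∧ u < lnr (-r) a) := by
    intro u hu
    refine ⟨by rw [subMod, if_pos hu], subMod_eq (lnr_lt _ ha) (Nat.mod_lt _ ha) ?_⟩
    have h0 := lnr_neg_add_mod r ha
    rw [Nat.mod_add_mod, ← Nat.add_mod_right,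
      show u + (r - a) + lnr (-r) a + a = u + (lnr (-r) a + r) by omega, ← Nat.add_mod_mod, h0,
      add_zero, Nat.mod_eq_of_lt hu]
  obtain ⟨ev, ev', hv'⟩ := key v hav
  obtain ⟨ew, ew', hw'⟩ := key w haw
  have hxv : (v + (r - a)) % a < a := Nat.mod_lt _ ha
  rw [tau_of_lt har haw] at hw1 hvw
  rw [tau_of_lt har hav] at hvw hv1
  have hbottom : XPath a (lnr (-r) a) K v w → XPath r a ((fun κ => r - a + κ) '' K) v w :=
    fun hp => hp.right ha har hra hK haw hw (Nat.mod_eq_of_lt hav) rfl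
  rw [ev, ew]
  rcases h v hav w haw ⟨κ, hκ, by simpa using hw1⟩ (by omega) ⟨κ', hκ', by simpa using hv1⟩ with
    ⟨hs, hp⟩ | ⟨hs, hle, hp⟩ | ⟨h1, h2, hp, hp'⟩
  · exact Or.inl ⟨by omega, hbottom hp⟩
  · rw [ev', ew'] at hp
    exact Or.inr (Or.inl ⟨by omega, hle, hp.right ha har hra hK hxv (by omega) rfl (by omega)⟩)
  · exact Or.inl ⟨by omega, hbottom hp⟩

end

/-! ### The cones of the fan -/

/-- A cone of the fan either contains `e₁`, and is then one of the `σ_i`, or is spanned by points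
`p_κ` with the property `HasXPaths`. -/
theorem fan_cases {r : ℕ} : ∀ {a : ℕ}, a < r → Nat.Coprime r a → ∀ σ ∈ fan r a,
    (∃ i < r, Set.range σ = {p r a i, p r a (i + 1), e₁}) ∨
    ∃ K : Set ℕ, (∀ κ ∈ K, κ ≤ r) ∧ Set.range σ = p r a '' K ∧ HasXPaths r a K := by
  induction r using Nat.strong_induction_on with
  | _ r ih =>
    intro a har hra σ hσ
    rcases Nat.eq_zero_or_pos a with rfl | ha
    · obtain rfl : r = 1 := (Nat.coprime_zero_right r).1 hra
      rw [fan, dif_neg (by omega), Set.mem_singleton_iff] at hσ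
      subst hσ
      have hval : ∀ x : ZMod 1, x.val = 0 := fun x => Nat.lt_one_iff.1 (ZMod.val_lt x)
      have h0 : p 1 0 0 = e₂ := by
        ext c
        fin_cases c <;> simp [p, e₂]
      have h1 : p 1 0 1 = e₃ := by
        ext c
        fin_cases c <;> simp [p, e₃, hval]
      refine Or.inl ⟨0, one_pos, ?_⟩
      rw [zero_add, h0, h1]
      simp only [Matrix.range_cons, Matrix.range_empty, Set.union_empty, Set.singleton_union]
      ext x; simp only [Set.mem_insert_iff, Set.mem_singleton_iff]; tauto
    · have hn : 0 < r - a := by omega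
      rw [fan, dif_pos ⟨ha, har⟩, lnr_natCast] at hσ
      rcases hσ with (⟨σ, hσ, rfl⟩ | ⟨σ, hσ, rfl⟩) | rfl
      · rw [Set.range_comp' (mapL r a) σ]
        rcases ih _ (by omega) (Nat.mod_lt _ hn) (coprime_left har hra) σ hσ with
          ⟨i, hi, hr⟩ | ⟨K, hK, hr, hp⟩
        · refine Or.inl ⟨i, by omega, ?_⟩
          rw [hr, Set.image_insert_eq, Set.image_pair, mapL_e₁, mapL_p ha har hra (by omega),
            mapL_p ha har hra (by omega)]
        · refine Or.inr ⟨K, fun κ hκ => (hK κ hκ).trans (Nat.sub_le _ _), ?_,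
            hp.left ha har hra hK⟩
          rw [hr, Set.image_image]
          exact Set.image_congr fun κ hκ => mapL_p ha har hra (hK κ hκ)
      · rw [Set.range_comp' (mapR r a) σ]
        rcases ih _ har (lnr_lt _ ha) (coprime_right ha hra) σ hσ with
          ⟨i, hi, hr⟩ | ⟨K, hK, hr, hp⟩
        · refine Or.inl ⟨r - a + i, by omega, ?_⟩
          rw [hr, Set.image_insert_eq, Set.image_pair, mapR_e₁, mapR_p ha har hra (by omega),
            mapR_p ha har hra (by omega), add_assoc]
        · refine Or.inr ⟨(fun κ => r - a + κ) '' K, ?_, ?_, hp.right ha har hra hK⟩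
          · rintro _ ⟨κ, hκ, rfl⟩
            have := hK κ hκ
            dsimp only
            omega
          · rw [hr, Set.image_image, Set.image_image]
            exact Set.image_congr fun κ hκ => mapR_p ha har hra (hK κ hκ)
      · refine Or.inr ⟨{0, r - a, r}, by simp, ?_, hasXPaths_central ha har hra⟩
        have hr' : (r : ℝ) ≠ 0 := Nat.cast_ne_zero.2 (by omega)
        have h0 : p r a 0 = e₂ := by
          ext c
          fin_cases c <;> simp [p, e₂, hr']
        have h1 : p r a r = e₃ := by
          ext c
          fin_cases c <;> simp [p, e₃, hr']
        rw [Set.image_insert_eq, Set.image_pair, h0, h1]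
        simp only [Matrix.range_cons, Matrix.range_empty, Set.union_empty, Set.singleton_union]
        exact Set.insert_comm _ _ _

/-! ### Sets of vertices closed under the arrows -/

/-- `S` is closed under the arrows whose divisors contain none of the prime divisors of the rays
in `R`. If `R` consists of the rays of a cone `σ`, such `S` are the supports of the
subrepresentations of the representation at the distinguished point of `U_σ`. -/
def ArrowClosed (r a : ℕ) (R : Set Vec) (S : Set (ZMod r)) : Prop :=
  ∀ ⦃i j : ZMod r⦄ (f : McKayArrow r a i j), (∀ v ∈ R, arrowDivisor f v = 0) → i ∈ S → j ∈ S

section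

variable {r a : ℕ} {S : Set (ZMod r)}

theorem cast_subMod (har : a ≤ r) (v : ℕ) :
    ((subMod r a v : ℕ) : ZMod r) = (v : ZMod r) - (a : ZMod r) := by
  unfold subMod
  split_ifs with h
  · rw [Nat.cast_add, Nat.cast_sub har, ZMod.natCast_self, zero_sub, sub_eq_add_neg]
  · exact Nat.cast_sub (not_lt.1 h)

theorem ArrowClosed.of_xPath {K : Set ℕ} (hS : ArrowClosed r a (p r a '' K) S) {u t : ℕ}
    (h : XPath r a K u t) (hu : (u : ZMod r) ∈ S) : (t : ZMod r) ∈ S := by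
  obtain ⟨hut, h⟩ := h
  induction t, hut using Nat.le_induction with
  | base => exact hu
  | succ t hut ih =>
    rw [Nat.cast_succ]
    refine hS (.x (t : ZMod r)) ?_ (ih fun i hi hi' => h i hi (hi'.trans (Nat.lt_succ_self t)))
    rintro _ ⟨κ, hκ, rfl⟩
    exact h t hut (Nat.lt_succ_self t) κ hκ

/-- If `S` contains `v` but not `v - a`, and `w - a` but not `w`, then `τ(v) ≤ τ(w)`: otherwise
a path of arrows `x` would contradict closedness. -/
theorem ArrowClosed.tau_le [NeZero r] (har : a < r) {K : Set ℕ}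
    (hKr : ∀ κ ∈ K, κ ≤ r) (hK : HasXPaths r a K) (hS : ArrowClosed r a (p r a '' K) S)
    {v w : ZMod r} (hv : v ∈ S) (hv' : v - (a : ZMod r) ∉ S) (hw : w - (a : ZMod r) ∈ S)
    (hw' : w ∉ S) :
    tau r a v.val ≤ tau r a w.val := by
  have hr : 0 < r := NeZero.pos r
  by_contra! hlt
  have h1 : ∃ κ ∈ K, tau r a v.val < κ := by
    by_contra! hc
    refine hv' (hS (.z v) ?_ hv)
    rintro _ ⟨κ, hκ, rfl⟩
    rw [arrowDivisor, divZ_apply_p a hr (hKr κ hκ), if_neg (hc κ hκ).not_gt]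
  have h2 : ∃ κ ∈ K, κ ≤ tau r a w.val := by
    by_contra! hc
    refine hw' ?_
    rw [← sub_add_cancel w (a : ZMod r)]
    refine hS (.y (w - (a : ZMod r))) ?_ hw
    rintro _ ⟨κ, hκ, rfl⟩
    rw [arrowDivisor, divY_apply_p a hr, sub_add_cancel, if_neg (hc κ hκ).not_ge]
  have hvw : XPath r a K v.val w.val → False := fun h =>
    hw' (by simpa using hS.of_xPath h (by simpa using hv))
  have hwv : XPath r a K (subMod r a w.val) (subMod r a v.val) → False := fun h => by
    have := hS.of_xPath h (by simpa [cast_subMod har.le] using hw)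
    exact hv' (by simpa [cast_subMod har.le] using this)
  rcases hK _ (ZMod.val_lt v) _ (ZMod.val_lt w) h2 hlt h1 with ⟨_, h⟩ | ⟨_, _, h⟩ | ⟨_, _, h, _⟩
  exacts [hvw h, hwv h, hvw h]

/-- If `S` is closed for some cone of the fan, then it is closed for one of the cones `σ_l`. -/
theorem ArrowClosed.exists_topCone [NeZero r] (har : a < r) (hra : Nat.Coprime r a) {σ : Triple}
    (hσ : σ ∈ fan r a) (hS : ArrowClosed r a (Set.range σ) S) :
    ∃ l < r, ArrowClosed r a (Set.range (topCone r a l)) S := by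
  classical
  have hr : 0 < r := NeZero.pos r
  have htop : ∀ l, Set.range (topCone r a l) = {p r a l, p r a (l + 1), e₁} := by
    intro l
    simp only [topCone, Matrix.range_cons, Matrix.range_empty, Set.union_empty,
      Set.singleton_union]
  rcases fan_cases har hra σ hσ with ⟨i, hi, hi'⟩ | ⟨K, hKr, hK', hK⟩
  · exact ⟨i, hi, by rwa [htop, ← hi']⟩
  rw [hK'] at hS
  -- Any `l` between the maximum of `τ` on the `v ∈ S` with `v - a ∉ S` and the minimum of `τ` on
  -- the `w ∉ S` with `w - a ∈ S` will do.
  set P : Finset (ZMod r) := Finset.univ.filter fun v => v ∈ S ∧ v - (a : ZMod r) ∉ S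
  set l := P.sup fun v => tau r a v.val
  have hlr : l < r := (Finset.sup_lt_iff hr).2 fun v _ => tau_lt har hra (ZMod.val_lt v)
  refine ⟨l, hlr, ?_⟩
  rw [htop]
  intro i j f hD hi
  cases f with
  | x =>
    have h := hD e₁ (by simp)
    rw [arrowDivisor, divX_apply_e₁ a hr] at h
    exact absurd h one_ne_zero
  | y =>
    have h := hD (p r a l) (by simp)
    rw [arrowDivisor, divY_apply_p a hr] at h
    by_contra hi'
    have hle : l ≤ tau r a (i + (a : ZMod r)).val := by
      refine Finset.sup_le fun v hv => ?_
      obtain ⟨_, h1, h2⟩ := Finset.mem_filter.1 hv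
      exact hS.tau_le har hKr hK h1 h2 (by rwa [add_sub_cancel_right]) hi'
    rw [if_pos hle] at h
    exact one_ne_zero h
  | z =>
    have h := hD (p r a (l + 1)) (by simp)
    rw [arrowDivisor, divZ_apply_p a hr (by omega)] at h
    by_contra hi'
    have hle : tau r a i.val ≤ l :=
      Finset.le_sup (f := fun v : ZMod r => tau r a v.val)
        (Finset.mem_filter.2 ⟨Finset.mem_univ _, hi, hi'⟩)
    rw [if_pos (by omega)] at h
    exact one_ne_zero h

end

/-! ### Subrepresentations -/

section

variable {r a : ℕ}

/-- A section does not vanish at a point outside the support of its divisor: any `χ^m` with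
divisor zero on `U_σ` is invertible. -/
theorem naturalSection_ne_zero {σ : Triple} (s : Chart r a σ.cone) {D : TDiv}
    (hD : ∀ v ∈ Set.range σ, D v = 0) : naturalSection σ s D ≠ 0 := by
  have hex : ∃ m : dualMonoid r a σ.cone, IsLocalEquation σ D m :=
    ⟨0, fun k => by rw [hD _ ⟨k, rfl⟩]; simp⟩
  rw [naturalSection, dif_pos hex]
  have hm := hex.choose_spec
  set m := hex.choose
  have hz : ∀ v ∈ σ.cone, m.1 ⬝ᵥ v = 0 := by
    intro v hv
    induction hv using Submodule.span_induction with
    | mem v hv =>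
      obtain ⟨k, rfl⟩ := hv
      rw [hm k, hD _ ⟨k, rfl⟩, Int.cast_zero]
    | zero => exact dotProduct_zero _
    | add x y _ _ hx hy => rw [dotProduct_add, hx, hy, add_zero]
    | smul c x _ hx =>
      rw [show c • x = (c : ℝ) • x from rfl, dotProduct_smul, hx, smul_zero]
  let m' : dualMonoid r a σ.cone :=
    ⟨-m.1, neg_mem m.2.1, fun v hv => by rw [neg_dotProduct, hz v hv, neg_zero]⟩
  have hmm : m + m' = 0 := Subtype.ext (add_neg_cancel m.1)
  intro h0
  have h1 : s (AddMonoidAlgebra.single m 1 * AddMonoidAlgebra.single m' 1) = 1 := by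
    rw [AddMonoidAlgebra.single_mul_single, hmm, one_mul]
    exact map_one s
  rw [map_mul, show s (AddMonoidAlgebra.single m 1) = 0 from h0, zero_mul] at h1
  exact zero_ne_one h1

/-- At the distinguished point of `U_σ`, a section vanishes as soon as its divisor contains the
divisor of a ray of `σ`; if `D` has no local equation, the section is `0` by convention. -/
theorem apply_eq_zero_of_naturalSection_ne_zero {σ : Triple} {D : TDiv}
    (h : naturalSection σ (torusFixedPoint r a σ.cone) D ≠ 0) : ∀ v ∈ Set.range σ, D v = 0 := by
  rintro _ ⟨k, rfl⟩
  unfold naturalSection at h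
  split_ifs at h with hex
  · rcases character_torusFixedPoint r a σ.cone hex.choose with ⟨h1, _⟩ | ⟨_, h1⟩
    · have h2 := hex.choose_spec k
      rw [h1 _ (PointedCone.subset_hull ⟨k, rfl⟩)] at h2
      exact_mod_cast h2.symm
    · exact absurd h1 h
  · exact absurd rfl h

/-- The vertices at which a subrepresentation is not zero. -/
def Subrep.support {V : Rep (McKayQuiver r a) (fun _ => 1)} (W : Subrep V) : Set (ZMod r) :=
  {v | W.space v ≠ ⊥}

theorem submodule_eq_top {U : Submodule ℂ (Fin 1 → ℂ)} (h : U ≠ ⊥) : U = ⊤ := by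
  have h1 : 0 < Module.finrank ℂ U := Submodule.one_le_finrank_iff.2 h
  refine Submodule.eq_top_of_finrank_eq (le_antisymm (Submodule.finrank_le U) ?_)
  rw [Module.finrank_fin_fun]
  exact h1

theorem Subrep.arrowClosed_support {σ : Triple} {s : Chart r a σ.cone}
    {V : Rep (McKayQuiver r a) (fun _ => 1)} (hV : Rep.Isomorphic (chartRep σ s) V)
    (W : Subrep V) : ArrowClosed r a (Set.range σ) W.support := by
  obtain ⟨g, hg⟩ := hV
  intro i j f hD hi
  obtain ⟨u, hu, hu0⟩ := (Submodule.ne_bot_iff _).1 hi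
  refine (Submodule.ne_bot_iff _).2 ⟨V (v := i) (w := j) f u, W.map_mem _ u hu, ?_⟩
  have h := hg (v := i) (w := j) f ((g i).symm u)
  rw [LinearEquiv.apply_symm_apply] at h
  rw [h]
  refine (LinearEquiv.map_ne_zero_iff _).2 ?_
  change naturalSection σ s (arrowDivisor f) • (g i).symm u ≠ 0
  exact smul_ne_zero (naturalSection_ne_zero s hD) ((LinearEquiv.map_ne_zero_iff _).2 hu0)

open scoped Classical in
/-- The subrepresentation of `F_l` supported on a closed set of vertices. -/
noncomputable def topSubrep {l : ℕ} {S : Set (ZMod r)}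
    (hS : ArrowClosed r a (Set.range (topCone r a l)) S) : Subrep (topRep r a l) where
  space v := if (v : ZMod r) ∈ S then ⊤ else ⊥
  map_mem := by
    intro i j f u hu
    by_cases hj : (j : ZMod r) ∈ S
    · rw [if_pos hj]; exact Submodule.mem_top
    · rw [if_neg hj, Submodule.mem_bot]
      by_cases hi : (i : ZMod r) ∈ S
      · change naturalSection _ _ (arrowDivisor (f : McKayArrow r a i j)) • u = 0
        by_cases h0 : naturalSection (topCone r a l) (torusFixedPoint r a (topCone r a l).cone)
            (arrowDivisor (f : McKayArrow r a i j)) = 0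
        · rw [h0, zero_smul]
        · exact absurd (hS f (apply_eq_zero_of_naturalSection_ne_zero h0) hi) hj
      · rw [if_neg hi, Submodule.mem_bot] at hu
        rw [hu, map_zero]

theorem topSubrep_space {l : ℕ} {V : Rep (McKayQuiver r a) (fun _ => 1)} {W : Subrep V}
    (hS : ArrowClosed r a (Set.range (topCone r a l)) W.support) :
    (topSubrep hS).space = W.space := by
  funext v
  by_cases hv : W.space v = ⊥
  · exact (if_neg (not_not.2 hv)).trans hv.symm
  · exact (if_pos hv).trans (submodule_eq_top hv).symm

/-- A subrepresentation at any point of the Danilov resolution has the same spaces as a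
subrepresentation of one of the `F_l`. -/
theorem exists_topSubrep [NeZero r] (har : a < r) (hra : Nat.Coprime r a) {y : Resolution r a}
    {V : Rep (McKayQuiver r a) (fun _ => 1)} (hV : IsFamilyRep y V) (W : Subrep V) :
    ∃ l < r, ∃ W' : Subrep (topRep r a l), W'.space = W.space := by
  obtain ⟨x, _, hx⟩ := hV
  obtain ⟨l, hl, hS⟩ := (W.arrowClosed_support hx).exists_topCone har hra x.1.2
  exact ⟨l, hl, topSubrep hS, topSubrep_space hS⟩

end

end Danilov

theorem mainTheorem4 (r a : ℕ) [NeZero r] (ha : 0 < a) (har : a < r) (hra : Nat.Coprime r a)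
    (θ : Danilov.Wt (Danilov.McKayQuiver r a)) :
    ((∀ i < r, Danilov.IsSemistable θ (Danilov.topRep r a i)) →
      ∀ (y : Danilov.Resolution r a)
        (V : Danilov.Rep (Danilov.McKayQuiver r a) (fun _ => 1)),
        Danilov.IsFamilyRep y V → Danilov.IsSemistable θ V) ∧
    ((∀ i < r, Danilov.IsStable θ (Danilov.topRep r a i)) →
      ∀ (y : Danilov.Resolution r a)
        (V : Danilov.Rep (Danilov.McKayQuiver r a) (fun _ => 1)),
        Danilov.IsFamilyRep y V → Danilov.IsStable θ V) := by
  refine ⟨fun h y V hV => ⟨(h 0 (NeZero.pos r)).1, fun W hW hW' => ?_⟩,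
    fun h y V hV => ⟨(h 0 (NeZero.pos r)).1, fun W hW hW' => ?_⟩⟩ <;>
  · obtain ⟨l, hl, W', hWW⟩ := Danilov.exists_topSubrep har hra hV W
    have hdim : W.dim = W'.dim := by
      funext v
      rw [Danilov.Subrep.dim, Danilov.Subrep.dim, hWW]
    rw [hdim]
    refine (h l hl).2 W' ?_ ?_
    · rwa [Danilov.Subrep.IsNonzero, hWW]
    · rwa [Danilov.Subrep.IsProper, hWW]
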